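/- Let $B,m\ge 1$ be integers and let $\mathcal X\subset\mathbb C$ be a finite constellation of size $2^M$ with zero mean and unit energy, i.e. $\frac{1}{|\mathcal X|}\sum_{x\in\mathcal X}x=0$ and $\frac{1}{|\mathcal X|}\sum_{x\in\mathcal X}|x|^2=1$. For $s\ge0$ let $$I_{\mathcal X}(s)=\mathbb E\left[\log_2\frac{e^{-|Y-\sqrt s X|^2}}{\sum_{x'\in\mathcal X}2^{-M}e^{-|Y-\sqrt s x'|^2}}\right],\qquad Y=\sqrt s\,X+W,$$ with $X$ uniform on $\mathcal X$ and $W\sim\mathcal{CN}(0,1)$ independent of $X$. Let $0<R<M$, $d_e>0$ and $d_{\mathrm{peak}}\ge 0$. For each $\mathrm{SNR}>1$ let $\mathbf h_i=\widehat{\mathbf h}_i+\mathbf e_i\in\mathbb C^m$, $i=1,\dots,B$, where the $\widehat{\mathbf h}_i$ and $\mathbf e_i$ are mutually independent complex Gaussian vectors with i.i.d. circularly symmetric zero-mean components, the components of $\mathbf e_i$ having variance $\mathrm{SNR}^{-d_e}$ and those of $\mathbf h_i$ variance $1$ (Rayleigh block fading with $B$ blocks, $m$ receive antennas and mismatched transmitter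 channel knowledge). Put $\gamma_i=\|\mathbf h_i\|^2$, $\hat\gamma_i=\|\widehat{\mathbf h}_i\|^2$ and $\hat{\boldsymbol\gamma}=(\hat\gamma_1,\dots,\hat\gamma_B)$. A power allocation is a measurable map $\hat{\boldsymbol\gamma}\mapsto(P_1(\hat{\boldsymbol\gamma}),\dots,P_B(\hat{\boldsymbol\gamma}))\in[0,\infty)^B$; it is admissible if $P(\hat{\boldsymbol\gamma})=\frac1B\sum_{i=1}^BP_i(\hat{\boldsymbol\gamma})$ satisfies $\mathbb E[P(\hat{\boldsymbol\gamma})]\le\mathrm{SNR}$ and $P(\hat{\boldsymbol\gamma})\le\mathrm{SNR}^{d_{\mathrm{peak}}}$ everywhere. Let $P_{\mathrm{out}}^\ast(\mathrm{SNR})$ be the infimum, over all admissible power allocations, of the outage probability $$\Pr\left\{\frac1B\sum_{i=1}^BI_{\mathcal X}\bigl(P_i(\hat{\boldsymbol\gamma})\gamma_i\bigr)<R\right\}.$$ Let $d_{\mathrm{SB}}=B-\lceil BR/M\rceil+1$. Then $P_{\mathrm{out}}^\ast(\mathrm{SNR})>0$ for all sufficiently large $\mathrm{SNR}$, and $$\lim_{\mathrm{SNR}\to\infty}-\frac{\log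 P_{\mathrm{out}}^\ast(\mathrm{SNR})}{\log\mathrm{SNR}}=\begin{cases}m\,d_{\mathrm{SB}}\,d_{\mathrm{peak}},& d_{\mathrm{peak}}\le 1+m\,d_{\mathrm{SB}}\,d_e,\\ m\,d_{\mathrm{SB}}\,(1+m\,d_{\mathrm{SB}}\,d_e),& d_{\mathrm{peak}}>1+m\,d_{\mathrm{SB}}\,d_e.\end{cases}$$ -/

import Mathlib

open MeasureTheory ProbabilityTheory Filter Topology
open scoped NNReal

namespace BlockFading

noncomputable section

/-- The circularly symmetric complex Gaussian law `CN(0, v)`: independent real and imaginary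
parts, each centred Gaussian of variance `v / 2`, so that `E|Z|² = v`. -/
def complexGaussian (v : ℝ≥0) : Measure ℂ :=
  ((gaussianReal 0 (v / 2)).prod (gaussianReal 0 (v / 2))).map Complex.measurableEquivRealProd.symm

/-- The law of `B` independent vectors of `ℂ^m`, each with i.i.d. `CN(0, v)` components. -/
def gaussianBlocks (B m : ℕ) (v : ℝ≥0) : Measure (Fin B → Fin m → ℂ) :=
  Measure.pi fun _ => Measure.pi fun _ => complexGaussian v

/-- The squared norms `‖h_i‖²` of the blocks of a vector of channel gains. -/
def gains {B m : ℕ} (h : Fin B → Fin m → ℂ) : Fin B → ℝ :=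
  fun i => ∑ j, ‖h i j‖ ^ 2

/-- The variance `SNR^(-d_e)` of the CSIT noise. -/
def csitNoiseVar (de snr : ℝ) : ℝ≥0 := (snr ^ (-de)).toNNReal

/-- The joint law of the channel estimate `ĥ` and the CSIT noise `e`. They are independent and
Gaussian, the noise has variance `SNR^(-d_e)`, and the estimate has variance `1 - SNR^(-d_e)`:
for `SNR ≥ 1` this is the only law for which the true channel `h = ĥ + e` is Rayleigh with unit
variances (see `map_add_csitLaw`). -/
def csitLaw (B m : ℕ) (de snr : ℝ) :
    Measure ((Fin B → Fin m → ℂ) × (Fin B → Fin m → ℂ)) :=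
  (gaussianBlocks B m (1 - csitNoiseVar de snr)).prod (gaussianBlocks B m (csitNoiseVar de snr))

/-- The mutual information `I_𝒳(s)`, in bits, between input and output of the complex AWGN channel
`Y = √s X + W`, `W ∼ CN(0, 1)`, with `X` uniform on the constellation `𝒳`:
`E[log₂ (exp (-|Y - √s X|²) / ∑_{x'} Q(x') exp (-|Y - √s x'|²))]` with `Q(x') = 1 / |𝒳|`. -/
def mutualInfo (X : Finset ℂ) (s : ℝ) : ℝ :=
  (∑ x ∈ X, ∫ w, Real.logb 2
      (Real.exp (-‖((√s : ℝ) * x + w) - (√s : ℝ) * x‖ ^ 2) /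
        ∑ x' ∈ X, (1 / (X.card : ℝ)) * Real.exp (-‖((√s : ℝ) * x + w) - (√s : ℝ) * x'‖ ^ 2))
      ∂(complexGaussian 1)) / X.card

/-- A power allocation: given the estimated gains `γ̂ = (γ̂_1, …, γ̂_B)`, the powers of the blocks. -/
abbrev PowerAllocation (B : ℕ) : Type := (Fin B → ℝ) → Fin B → ℝ

/-- The normalized total power `P(γ̂) = (1/B) ∑ P_i(γ̂)`. -/
def avgPower {B : ℕ} (P : PowerAllocation B) (g : Fin B → ℝ) : ℝ := (∑ i, P g i) / B

/-- The admissible power allocations: measurable, nonnegative, of expected normalized total power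
at most `SNR`, and of normalized total power at most `SNR^(d_peak)` everywhere. (The last
condition bounds the integrand, so that the expectation is that of an integrable function.) -/
structure Admissible (B m : ℕ) (de dpeak snr : ℝ) (P : PowerAllocation B) : Prop where
  measurable : Measurable P
  nonneg : ∀ g i, 0 ≤ P g i
  average : ∫ z, avgPower P (gains z.1) ∂(csitLaw B m de snr) ≤ snr
  peak : ∀ g, avgPower P g ≤ snr ^ dpeak

/-- The outage probability `Pr{(1/B) ∑ I_𝒳(P_i(γ̂) γ_i) < R}` of a power allocation, where
`γ_i = ‖ĥ_i + e_i‖²` and `γ̂_i = ‖ĥ_i‖²`. -/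
def outageProb (B m : ℕ) (X : Finset ℂ) (R de snr : ℝ) (P : PowerAllocation B) : ℝ :=
  (csitLaw B m de snr).real
    {z | (∑ i, mutualInfo X (P (gains z.1) i * gains (z.1 + z.2) i)) / B < R}

/-- The optimal outage probability: the infimum over all admissible power allocations. -/
def optimalOutage (B m : ℕ) (X : Finset ℂ) (R de dpeak snr : ℝ) : ℝ :=
  sInf (outageProb B m X R de snr '' {P | Admissible B m de dpeak snr P})

/-- The Singleton bound `d_SB = B - ⌈BR/M⌉ + 1`. -/
def singletonBound (B : ℕ) (R M : ℝ) : ℤ := (B : ℤ) - ⌈(B : ℝ) * R / M⌉ + 1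

instance isProbabilityMeasure_complexGaussian (v : ℝ≥0) :
    IsProbabilityMeasure (complexGaussian v) :=
  Measure.isProbabilityMeasure_map Complex.measurableEquivRealProd.symm.measurable.aemeasurable

instance isProbabilityMeasure_gaussianBlocks (B m : ℕ) (v : ℝ≥0) :
    IsProbabilityMeasure (gaussianBlocks B m v) := by
  unfold gaussianBlocks; infer_instance

theorem map_add_prod_prod (μ₁ μ₂ ν₁ ν₂ : Measure ℝ)
    [SFinite μ₁] [SFinite ν₁] [SFinite μ₂] [SFinite ν₂] :
    ((μ₁.prod μ₂).prod (ν₁.prod ν₂)).map (fun p => p.1 + p.2) =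
      ((μ₁.prod ν₁).map fun p => p.1 + p.2).prod ((μ₂.prod ν₂).map fun p => p.1 + p.2) := by
  rw [Measure.map_prod_map _ _ (by fun_prop) (by fun_prop)]
  refine Measure.ext_of_lintegral _ fun f hf => ?_
  have h1 : Measurable fun z : (ℝ × ℝ) × ℝ × ℝ => f (z.1 + z.2) :=
    hf.comp (measurable_fst.add measurable_snd)
  have h2 : Measurable fun z : (ℝ × ℝ) × ℝ × ℝ =>
      f (Prod.map (fun p : ℝ × ℝ => p.1 + p.2) (fun p : ℝ × ℝ => p.1 + p.2) z) := by fun_prop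
  have h0 : Measurable fun z : (ℝ × ℝ) × ℝ × ℝ => z.1 + z.2 := measurable_fst.add measurable_snd
  rw [lintegral_map hf h0, lintegral_map hf (by fun_prop),
    lintegral_prod _ h1.aemeasurable, lintegral_prod _ h1.lintegral_prod_right'.aemeasurable,
    lintegral_prod _ h2.aemeasurable, lintegral_prod _ h2.lintegral_prod_right'.aemeasurable]
  refine lintegral_congr fun x => ?_
  have h3 : Measurable fun z : ℝ × ℝ × ℝ => f (x + z.2.1, z.1 + z.2.2) := by fun_prop
  calc ∫⁻ y, ∫⁻ z, f ((x, y) + z) ∂ν₁.prod ν₂ ∂μ₂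
      = ∫⁻ y, ∫⁻ x', ∫⁻ y', f (x + x', y + y') ∂ν₂ ∂ν₁ ∂μ₂ := by
        refine lintegral_congr fun y => ?_
        have h4 : Measurable fun z : ℝ × ℝ => f (x + z.1, y + z.2) := by fun_prop
        exact lintegral_prod _ h4.aemeasurable
    _ = ∫⁻ x', ∫⁻ y, ∫⁻ y', f (x + x', y + y') ∂ν₂ ∂μ₂ ∂ν₁ := by
        refine lintegral_lintegral_swap (Measurable.aemeasurable ?_)
        have h4 : Measurable fun z : (ℝ × ℝ) × ℝ => f (x + z.1.2, z.1.1 + z.2) := by fun_prop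
        exact h4.lintegral_prod_right'
    _ = _ := by
        refine lintegral_congr fun x' => ?_
        have h4 : Measurable fun z : ℝ × ℝ => f (x + x', z.1 + z.2) := by fun_prop
        exact (lintegral_prod _ h4.aemeasurable).symm

theorem map_add_prod_complexGaussian (v w : ℝ≥0) :
    ((complexGaussian v).prod (complexGaussian w)).map (fun p => p.1 + p.2) =
      complexGaussian (v + w) := by
  have hg : ∀ a b : ℝ≥0, ((gaussianReal 0 a).prod (gaussianReal 0 b)).map (fun p => p.1 + p.2) =
      gaussianReal 0 (a + b) := fun a b => by
    have := gaussianReal_conv_gaussianReal (m₁ := 0) (m₂ := 0) (v₁ := a) (v₂ := b)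
    simpa [Measure.conv] using this
  have h := map_add_prod_prod (gaussianReal 0 (v / 2)) (gaussianReal 0 (v / 2))
    (gaussianReal 0 (w / 2)) (gaussianReal 0 (w / 2))
  rw [hg, ← add_div] at h
  unfold complexGaussian
  rw [← h, Measure.map_prod_map _ _ (MeasurableEquiv.measurable _) (MeasurableEquiv.measurable _),
    Measure.map_map (by fun_prop) (by fun_prop), Measure.map_map (by fun_prop) (by fun_prop)]
  rfl

theorem map_add_pi {ι E : Type*} [Fintype ι] [MeasurableSpace E] [Add E] [MeasurableAdd₂ E]
    (μ ν ρ : Measure E) [IsProbabilityMeasure μ] [IsProbabilityMeasure ν] [IsProbabilityMeasure ρ]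
    (h : (μ.prod ν).map (fun p => p.1 + p.2) = ρ) :
    ((Measure.pi fun _ : ι => μ).prod (Measure.pi fun _ : ι => ν)).map (fun p => p.1 + p.2) =
      Measure.pi fun _ : ι => ρ := by
  have hp := measurePreserving_arrowProdEquivProdArrow E E ι (fun _ => μ) (fun _ => ν)
  rw [← hp.map_eq, Measure.map_map (by fun_prop) (MeasurableEquiv.measurable _)]
  subst h
  exact Measure.pi_map_pi (μ := fun _ : ι => μ.prod ν) (f := fun _ p => p.1 + p.2)
    (fun _ => (measurable_fst.add measurable_snd).aemeasurable)

/-- The true channel `h = ĥ + e` has i.i.d. `CN(0, 1)` components. -/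
theorem map_add_csitLaw (B m : ℕ) {de snr : ℝ} (hde : 0 ≤ de) (hsnr : 1 ≤ snr) :
    (csitLaw B m de snr).map (fun z => z.1 + z.2) = gaussianBlocks B m 1 := by
  have hle : csitNoiseVar de snr ≤ 1 := by
    rw [csitNoiseVar, Real.toNNReal_le_one]
    exact Real.rpow_le_one_of_one_le_of_nonpos hsnr (by linarith)
  refine map_add_pi _ _ _ (map_add_pi _ _ _ ?_)
  rw [map_add_prod_complexGaussian, tsub_add_cancel_of_le hle]

end

end BlockFading

/-! Write `d` for the Singleton bound, `k = m * d` and `S` for the SNR. A block carries almost `M`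
bits when its received power is large and almost none when it is small, and `d` is the least number
of weak blocks that forces an outage. If the available power never exceeds `S ^ a`, a typical outage
has `d` gains below about `S ^ (-a)`, an event of probability about `S ^ (-k * a)`. The question is
how large `a` can be.

Converse. The peak constraint gives `a ≤ dpeak` (`le_outageProb_of_peak`). The average constraint
gives `a ≤ 1 + k * de` (`le_outageProb_of_average`): the estimate is of the order of its own error
on `d` blocks with probability about `S ^ (-k * de)`. By Markov's inequality the power is at most
about `S ^ (1 + k * de)` on half of that event, and there the error can still cancel the estimate
almost exactly.

Achievability. Spend about `S ^ (1 + k * α)` when the weakest `d` estimated gains are about `S ^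
(-α)`, for `α` up to `de`, cut at the peak. Quantizing `α` costs an arbitrarily small exponent in
the mean power (`integral_inversionPower_le`). Weak reception of `d` blocks then means truly small
gains or an error far above its standard deviation (`small_gains_or_large_noise`), and the latter is
exponentially unlikely.

When `B * R / M` is an integer, `B - d + 1` strong blocks only just miss the rate. The remaining
blocks must supply the deficit, which is exponentially small, so a lower bound for the information
at low power is also needed (`exists_mul_le_mutualInfo`); zero mean and unit energy enter there.

Outage events are only compared by inclusion with simpler events, so their measurability plays no
role. -/

namespace BlockFading

noncomputable section

/-! ### Moments of linear forms of a complex Gaussian. -/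

/-- The real inner product on `ℂ`. -/
def dot (c w : ℂ) : ℝ := c.re * w.re + c.im * w.im

theorem norm_sq_eq (c : ℂ) : ‖c‖ ^ 2 = c.re ^ 2 + c.im ^ 2 := by
  rw [Complex.sq_norm, Complex.normSq_apply]; ring

theorem norm_add_sq_eq_dot (c w : ℂ) : ‖c + w‖ ^ 2 = ‖c‖ ^ 2 + 2 * dot c w + ‖w‖ ^ 2 := by
  simp only [norm_sq_eq, dot, Complex.add_re, Complex.add_im]; ring

theorem dot_sq_le (c w : ℂ) : dot c w ^ 2 ≤ ‖c‖ ^ 2 * ‖w‖ ^ 2 := by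
  simp only [norm_sq_eq, dot]; nlinarith [sq_nonneg (c.re * w.im - c.im * w.re)]

theorem integrable_exp_dot (v : ℝ≥0) (c : ℂ) :
    Integrable (fun w => Real.exp (dot c w)) (complexGaussian v) := by
  unfold complexGaussian
  rw [integrable_map_equiv]
  have h := (integrable_exp_mul_gaussianReal (μ := 0) (v := v / 2) c.re).mul_prod
    (integrable_exp_mul_gaussianReal (μ := 0) (v := v / 2) c.im)
  refine h.congr (ae_of_all _ fun z => ?_)
  simp [dot, Real.exp_add, Complex.measurableEquivRealProd]

theorem integral_exp_dot (v : ℝ≥0) (c : ℂ) :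
    ∫ w, Real.exp (dot c w) ∂(complexGaussian v) = Real.exp (v * ‖c‖ ^ 2 / 4) := by
  unfold complexGaussian
  rw [MeasureTheory.integral_map_equiv]
  have hm : ∀ t : ℝ, ∫ x, Real.exp (t * x) ∂(gaussianReal 0 (v / 2)) =
      Real.exp (v * t ^ 2 / 4) := fun t => by
    have := mgf_gaussianReal (p := gaussianReal 0 (v / 2)) (X := id) (μ := 0) (v := v / 2)
      Measure.map_id t
    simp only [mgf, id] at this
    rw [this]; push_cast; congr 1; ring
  have : ∀ z : ℝ × ℝ, Real.exp (dot c (Complex.measurableEquivRealProd.symm z)) =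
      Real.exp (c.re * z.1) * Real.exp (c.im * z.2) := fun z => by
    simp [dot, Real.exp_add, Complex.measurableEquivRealProd]
  simp_rw [this]
  rw [integral_prod_mul (fun x => Real.exp (c.re * x)) (fun x => Real.exp (c.im * x)), hm, hm,
    ← Real.exp_add, norm_sq_eq]
  congr 1; ring

theorem integrable_dot (v : ℝ≥0) (c : ℂ) : Integrable (dot c) (complexGaussian v) := by
  unfold complexGaussian
  rw [integrable_map_equiv]
  have hi : Integrable (fun x : ℝ => x) (gaussianReal 0 (v / 2)) :=
    (memLp_id_gaussianReal (μ := 0) (v := v / 2) 1).integrable (by simp)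
  exact ((hi.comp_fst _).const_mul c.re).add ((hi.comp_snd _).const_mul c.im)

theorem integral_dot (v : ℝ≥0) (c : ℂ) : ∫ w, dot c w ∂(complexGaussian v) = 0 := by
  unfold complexGaussian
  rw [MeasureTheory.integral_map_equiv]
  have hi : Integrable (fun x : ℝ => x) (gaussianReal 0 (v / 2)) :=
    (memLp_id_gaussianReal (μ := 0) (v := v / 2) 1).integrable (by simp)
  have : ∀ z : ℝ × ℝ, dot c (Complex.measurableEquivRealProd.symm z) =
      c.re * z.1 + c.im * z.2 := fun z => by simp [dot, Complex.measurableEquivRealProd]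
  simp_rw [this]
  rw [integral_add ((hi.comp_fst _).const_mul c.re) ((hi.comp_snd _).const_mul c.im),
    integral_const_mul, integral_const_mul, integral_fun_fst (fun x : ℝ => x),
    integral_fun_snd (fun x : ℝ => x)]
  simp

/-! ### Bounds on the mutual information at high and low power. -/

/-- The ratio of the output density of the channel to its density given the input `x`, at the
output `a x + w`. -/
def densityRatio (X : Finset ℂ) (a : ℝ) (x w : ℂ) : ℝ :=
  ∑ x' ∈ X, (1 / (X.card : ℝ)) *
    Real.exp (-(a ^ 2 * ‖x - x'‖ ^ 2) + dot (((-2 * a : ℝ) : ℂ) * (x - x')) w)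

section
variable {X : Finset ℂ} {x : ℂ}

theorem card_pos_of_mem (hx : x ∈ X) : 0 < (X.card : ℝ) := by
  exact_mod_cast Finset.card_pos.2 ⟨x, hx⟩

theorem inv_card_le_densityRatio (hx : x ∈ X) (a : ℝ) (w : ℂ) :
    1 / (X.card : ℝ) ≤ densityRatio X a x w := by
  have h := Finset.single_le_sum (f := fun x' => (1 / (X.card : ℝ)) *
    Real.exp (-(a ^ 2 * ‖x - x'‖ ^ 2) + dot (((-2 * a : ℝ) : ℂ) * (x - x')) w))
    (fun i _ => by positivity) hx
  simpa [densityRatio, dot] using h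

theorem densityRatio_pos (hx : x ∈ X) (a : ℝ) (w : ℂ) : 0 < densityRatio X a x w :=
  (one_div_pos.2 (card_pos_of_mem hx)).trans_le (inv_card_le_densityRatio hx a w)

theorem measurable_densityRatio (a : ℝ) : Measurable (densityRatio X a x) := by
  unfold densityRatio dot; fun_prop

theorem neg_log_densityRatio_le_log_card (hx : x ∈ X) (a : ℝ) (w : ℂ) :
    -Real.log (densityRatio X a x w) ≤ Real.log X.card := by
  have hN := card_pos_of_mem hx
  have h := Real.log_le_log (one_div_pos.2 hN) (inv_card_le_densityRatio hx a w)
  rw [one_div, Real.log_inv] at h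
  linarith

/-- Halving the exponents is what yields decay. For `f = -a²D² - 2a⟨x - x', w⟩` with `D = ‖x - x'‖`,
the mean of `exp f` is `1`, whereas the mean of `exp (f / 2)` is `exp (-a²D² / 4)`. -/
theorem log_one_add_sum_le {ι : Type*} (s : Finset ι) (f : ι → ℝ) :
    Real.log (1 + ∑ i ∈ s, Real.exp (f i)) ≤ 2 * ∑ i ∈ s, Real.exp (f i / 2) := by
  have hs : 0 ≤ ∑ i ∈ s, Real.exp (f i / 2) := Finset.sum_nonneg fun _ _ => (Real.exp_pos _).le
  have h1 : ∑ i ∈ s, Real.exp (f i) ≤ (∑ i ∈ s, Real.exp (f i / 2)) ^ 2 := by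
    have := Finset.sum_sq_le_sq_sum_of_nonneg (s := s) (f := fun i => Real.exp (f i / 2))
      (fun _ _ => (Real.exp_pos _).le)
    refine le_trans (le_of_eq (Finset.sum_congr rfl fun i _ => ?_)) this
    rw [sq, ← Real.exp_add]; congr 1; ring
  have h0 : 0 ≤ ∑ i ∈ s, Real.exp (f i) := Finset.sum_nonneg fun _ _ => (Real.exp_pos _).le
  calc Real.log (1 + ∑ i ∈ s, Real.exp (f i))
      ≤ Real.log ((1 + ∑ i ∈ s, Real.exp (f i / 2)) ^ 2) :=
        Real.log_le_log (by positivity) (by nlinarith)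
    _ = 2 * Real.log (1 + ∑ i ∈ s, Real.exp (f i / 2)) := by rw [Real.log_pow]; norm_num
    _ ≤ _ := by
        have := Real.log_le_sub_one_of_pos (show 0 < 1 + ∑ i ∈ s, Real.exp (f i / 2) by positivity)
        linarith

theorem le_neg_log_densityRatio (hx : x ∈ X) (a : ℝ) (w : ℂ) :
    Real.log X.card - 2 * ∑ x' ∈ X.erase x, Real.exp (-(a ^ 2 * ‖x - x'‖ ^ 2) / 2) *
      Real.exp (dot (((-a : ℝ) : ℂ) * (x - x')) w) ≤ -Real.log (densityRatio X a x w) := by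
  have hN := card_pos_of_mem hx
  have hr : densityRatio X a x w = (1 / (X.card : ℝ)) * (1 + ∑ x' ∈ X.erase x,
      Real.exp (-(a ^ 2 * ‖x - x'‖ ^ 2) + dot (((-2 * a : ℝ) : ℂ) * (x - x')) w)) := by
    unfold densityRatio
    rw [← Finset.mul_sum, ← Finset.add_sum_erase _ _ hx]
    simp [dot]
  have h0 : 0 ≤ ∑ x' ∈ X.erase x,
      Real.exp (-(a ^ 2 * ‖x - x'‖ ^ 2) + dot (((-2 * a : ℝ) : ℂ) * (x - x')) w) :=
    Finset.sum_nonneg fun _ _ => (Real.exp_pos _).le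
  rw [hr, Real.log_mul (by positivity) (by positivity), one_div, Real.log_inv]
  have := log_one_add_sum_le (X.erase x)
    fun x' => -(a ^ 2 * ‖x - x'‖ ^ 2) + dot (((-2 * a : ℝ) : ℂ) * (x - x')) w
  have h2 : ∀ x', Real.exp ((-(a ^ 2 * ‖x - x'‖ ^ 2) +
      dot (((-2 * a : ℝ) : ℂ) * (x - x')) w) / 2) = Real.exp (-(a ^ 2 * ‖x - x'‖ ^ 2) / 2) *
      Real.exp (dot (((-a : ℝ) : ℂ) * (x - x')) w) := fun x' => by
    rw [← Real.exp_add]; congr 1; simp [dot]; ring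
  simp_rw [h2] at this
  linarith

theorem integrable_log_densityRatio (hx : x ∈ X) (a : ℝ) (v : ℝ≥0) :
    Integrable (fun w => -Real.log (densityRatio X a x w)) (complexGaussian v) := by
  have hg : Integrable (fun w => Real.log X.card - 2 * ∑ x' ∈ X.erase x,
      Real.exp (-(a ^ 2 * ‖x - x'‖ ^ 2) / 2) *
      Real.exp (dot (((-a : ℝ) : ℂ) * (x - x')) w)) (complexGaussian v) :=
    (integrable_const _).sub (Integrable.const_mul (integrable_finsetSum (X.erase x) fun x' _ =>
      (integrable_exp_dot v (((-a : ℝ) : ℂ) * (x - x'))).const_mul _) 2)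
  refine (hg.norm.add (integrable_const |Real.log X.card|)).mono'
    (Real.measurable_log.comp (measurable_densityRatio a)).neg.aestronglyMeasurable
    (ae_of_all _ fun w => ?_)
  have h1 := le_neg_log_densityRatio hx a w
  have h2 := neg_log_densityRatio_le_log_card hx a w
  simp only [Real.norm_eq_abs, Pi.add_apply]
  refine abs_le.2 ⟨?_, ?_⟩
  · linarith [neg_abs_le (Real.log X.card - 2 * ∑ x' ∈ X.erase x,
      Real.exp (-(a ^ 2 * ‖x - x'‖ ^ 2) / 2) *
      Real.exp (dot (((-a : ℝ) : ℂ) * (x - x')) w)), abs_nonneg (Real.log X.card)]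
  · linarith [abs_nonneg (Real.log X.card - 2 * ∑ x' ∈ X.erase x,
      Real.exp (-(a ^ 2 * ‖x - x'‖ ^ 2) / 2) *
      Real.exp (dot (((-a : ℝ) : ℂ) * (x - x')) w)), le_abs_self (Real.log X.card)]

/-- The relative entropy (in nats) of the output law given `x` with respect to the output law. -/
def outputDivergence (X : Finset ℂ) (a : ℝ) (x : ℂ) : ℝ :=
  ∫ w, -Real.log (densityRatio X a x w) ∂(complexGaussian 1)

theorem mutualInfo_eq (X : Finset ℂ) (s : ℝ) :
    mutualInfo X s = (∑ x ∈ X, outputDivergence X (√s) x) / X.card / Real.log 2 := by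
  rw [div_right_comm, Finset.sum_div]
  unfold mutualInfo
  refine congrArg (· / (X.card : ℝ)) ?_
  refine Finset.sum_congr rfl fun x hx => ?_
  rw [outputDivergence, ← integral_div]
  refine integral_congr_ae (ae_of_all _ fun w => ?_)
  have hr : (∑ x' ∈ X, (1 / (X.card : ℝ)) *
      Real.exp (-‖((√s : ℝ) * x + w) - (√s : ℝ) * x'‖ ^ 2)) =
      Real.exp (-‖w‖ ^ 2) * densityRatio X (√s) x w := by
    unfold densityRatio
    rw [Finset.mul_sum]
    refine Finset.sum_congr rfl fun x' _ => ?_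
    rw [mul_left_comm, ← Real.exp_add]
    congr 2
    rw [show ((√s : ℝ) : ℂ) * x + w - (√s : ℝ) * x' = ((√s : ℝ) : ℂ) * (x - x') + w by ring,
      norm_add_sq_eq_dot, norm_mul, Complex.norm_real, mul_pow, Real.norm_eq_abs, sq_abs]
    simp [dot]; ring
  have hd := densityRatio_pos hx (√s) w
  simp only
  rw [hr, add_sub_cancel_left, Real.logb, Real.log_div (by positivity) (by positivity),
    Real.log_mul (by positivity) (by positivity)]
  congr 1; ring

theorem outputDivergence_le_log_card (hx : x ∈ X) (a : ℝ) :
    outputDivergence X a x ≤ Real.log X.card := by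
  have := integral_mono (integrable_log_densityRatio hx a 1)
    (integrable_const (Real.log X.card)) (neg_log_densityRatio_le_log_card hx a)
  simpa [outputDivergence] using this

/-- Jensen's inequality for `exp` bounds the negative logarithm by the average of the negated
exponents, whose part linear in the noise has mean zero. -/
theorem outputDivergence_le_mul_sq (hx : x ∈ X) (a : ℝ) :
    outputDivergence X a x ≤ a ^ 2 * ∑ x' ∈ X, ‖x - x'‖ ^ 2 := by
  have hN := card_pos_of_mem hx
  have hN1 : (1 : ℝ) ≤ X.card := by exact_mod_cast Finset.card_pos.2 ⟨x, hx⟩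
  have hp : ∀ w, -Real.log (densityRatio X a x w) ≤ ∑ x' ∈ X, (1 / (X.card : ℝ)) *
      (a ^ 2 * ‖x - x'‖ ^ 2 - dot (((-2 * a : ℝ) : ℂ) * (x - x')) w) := fun w => by
    have h := convexOn_exp.map_sum_le (t := X) (w := fun _ => 1 / (X.card : ℝ))
      (p := fun x' => -(a ^ 2 * ‖x - x'‖ ^ 2) + dot (((-2 * a : ℝ) : ℂ) * (x - x')) w)
      (fun _ _ => by positivity) (by simp [hN.ne']) (fun _ _ => Set.mem_univ _)
    have h' := (Real.le_log_iff_exp_le (densityRatio_pos hx a w)).2 h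
    refine neg_le.1 (le_trans (le_of_eq ?_) h')
    rw [← Finset.sum_neg_distrib]
    exact Finset.sum_congr rfl fun x' _ => by rw [smul_eq_mul]; ring
  have hi : ∀ x' ∈ X, Integrable (fun w => (1 / (X.card : ℝ)) *
      (a ^ 2 * ‖x - x'‖ ^ 2 - dot (((-2 * a : ℝ) : ℂ) * (x - x')) w)) (complexGaussian 1) :=
    fun x' _ => ((integrable_const _).sub (integrable_dot 1 _)).const_mul _
  have := integral_mono (integrable_log_densityRatio hx a 1) (integrable_finsetSum _ hi) hp
  refine this.trans ?_
  rw [integral_finsetSum _ hi, Finset.mul_sum]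
  refine Finset.sum_le_sum fun x' _ => ?_
  rw [integral_const_mul, integral_sub (integrable_const _) (integrable_dot 1 _), integral_dot]
  simp only [integral_const, probReal_univ, one_smul, sub_zero]
  refine mul_le_of_le_one_left (by positivity) ?_
  rw [div_le_one hN]; exact hN1

theorem log_card_sub_le_outputDivergence (hx : x ∈ X) (a : ℝ) :
    Real.log X.card - 2 * ∑ x' ∈ X.erase x, Real.exp (-(a ^ 2 * ‖x - x'‖ ^ 2) / 4) ≤
      outputDivergence X a x := by
  have hi : ∀ x' ∈ X.erase x, Integrable (fun w =>
      Real.exp (-(a ^ 2 * ‖x - x'‖ ^ 2) / 2) *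
      Real.exp (dot (((-a : ℝ) : ℂ) * (x - x')) w)) (complexGaussian 1) := fun x' _ =>
    (integrable_exp_dot 1 _).const_mul _
  have hs := (integrable_finsetSum _ hi).const_mul 2
  have := integral_mono ((integrable_const (Real.log X.card)).sub hs)
    (integrable_log_densityRatio hx a 1) (le_neg_log_densityRatio hx a)
  refine le_trans (le_of_eq ?_) this
  have h0 : ∀ x', ∫ w, Real.exp (-(a ^ 2 * ‖x - x'‖ ^ 2) / 2) *
      Real.exp (dot (((-a : ℝ) : ℂ) * (x - x')) w) ∂(complexGaussian 1) =
      Real.exp (-(a ^ 2 * ‖x - x'‖ ^ 2) / 4) := fun x' => by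
    rw [integral_const_mul, integral_exp_dot, ← Real.exp_add]
    congr 1
    rw [norm_mul, Complex.norm_real, mul_pow, Real.norm_eq_abs, sq_abs, NNReal.coe_one]
    ring
  rw [integral_sub' (integrable_const _) hs, integral_const_mul, integral_finsetSum _ hi]
  simp only [h0, integral_const, probReal_univ, one_smul]

/-- Gibbs' variational inequality for the relative entropy, with the linear test function
`y ↦ t ⟨x, y⟩`. -/
theorem gibbs_outputDivergence (hx : x ∈ X) (a t : ℝ) :
    t * a * ‖x‖ ^ 2 + 1 - ∑ x' ∈ X, (1 / (X.card : ℝ)) *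
      Real.exp (t * a * dot x x' + t ^ 2 * ‖x‖ ^ 2 / 4) ≤ outputDivergence X a x := by
  have hi : ∀ x' ∈ X, Integrable (fun w => (1 / (X.card : ℝ)) *
      (Real.exp (t * a * ‖x‖ ^ 2 - a ^ 2 * ‖x - x'‖ ^ 2) *
        Real.exp (dot ((t : ℂ) * x + ((-2 * a : ℝ) : ℂ) * (x - x')) w))) (complexGaussian 1) :=
    fun x' _ => ((integrable_exp_dot 1 _).const_mul _).const_mul _
  have hs := integrable_finsetSum _ hi
  have hl₀ : Integrable (fun w => t * a * ‖x‖ ^ 2 + t * dot x w) (complexGaussian 1) :=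
    (integrable_const _).add ((integrable_dot 1 x).const_mul t)
  have hl : Integrable (fun w => t * a * ‖x‖ ^ 2 + t * dot x w + 1) (complexGaussian 1) :=
    hl₀.add (integrable_const _)
  have hp : ∀ w, t * a * ‖x‖ ^ 2 + t * dot x w + 1 - ∑ x' ∈ X, (1 / (X.card : ℝ)) *
      (Real.exp (t * a * ‖x‖ ^ 2 - a ^ 2 * ‖x - x'‖ ^ 2) *
        Real.exp (dot ((t : ℂ) * x + ((-2 * a : ℝ) : ℂ) * (x - x')) w)) ≤
      -Real.log (densityRatio X a x w) := fun w => by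
    -- The variational inequality is `log u ≤ u - 1` applied to the density ratio times `exp` of the
    -- test function.
    have hd := densityRatio_pos hx a w
    have h := Real.log_le_sub_one_of_pos
      (mul_pos hd (Real.exp_pos (t * a * ‖x‖ ^ 2 + t * dot x w)))
    rw [Real.log_mul hd.ne' (Real.exp_pos _).ne', Real.log_exp] at h
    have h2 : densityRatio X a x w * Real.exp (t * a * ‖x‖ ^ 2 + t * dot x w) =
        ∑ x' ∈ X, (1 / (X.card : ℝ)) *
      (Real.exp (t * a * ‖x‖ ^ 2 - a ^ 2 * ‖x - x'‖ ^ 2) *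
        Real.exp (dot ((t : ℂ) * x + ((-2 * a : ℝ) : ℂ) * (x - x')) w)) := by
      unfold densityRatio
      rw [Finset.sum_mul]
      refine Finset.sum_congr rfl fun x' _ => ?_
      rw [mul_assoc, ← Real.exp_add, ← Real.exp_add]
      congr 2
      simp [dot]; ring
    linarith
  have := integral_mono (hl.sub hs) (integrable_log_densityRatio hx a 1) hp
  refine le_trans (le_of_eq ?_) this
  rw [integral_sub' hl hs, integral_finsetSum _ hi, integral_add hl₀ (integrable_const _),
    integral_add (integrable_const _) ((integrable_dot 1 x).const_mul t), integral_const_mul t,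
    integral_dot]
  have h0 : ∀ x', ∫ w, (1 / (X.card : ℝ)) *
      (Real.exp (t * a * ‖x‖ ^ 2 - a ^ 2 * ‖x - x'‖ ^ 2) *
        Real.exp (dot ((t : ℂ) * x + ((-2 * a : ℝ) : ℂ) * (x - x')) w)) ∂(complexGaussian 1) =
      (1 / (X.card : ℝ)) * Real.exp (t * a * dot x x' + t ^ 2 * ‖x‖ ^ 2 / 4) := fun x' => by
    rw [integral_const_mul, integral_const_mul, integral_exp_dot, ← Real.exp_add]
    congr 2
    simp [norm_sq_eq, dot]; ring
  simp only [h0, integral_const, probReal_univ, one_smul, mul_zero, add_zero]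

end

section
variable {X : Finset ℂ} {M : ℝ}

theorem log_card_eq (hcard : (X.card : ℝ) = 2 ^ M) : Real.log X.card = M * Real.log 2 := by
  rw [hcard, Real.log_rpow two_pos]

theorem card_pos_of_eq_two_rpow (hcard : (X.card : ℝ) = 2 ^ M) : 0 < (X.card : ℝ) := by
  rw [hcard]; positivity

theorem mutualInfo_le (hcard : (X.card : ℝ) = 2 ^ M) (s : ℝ) : mutualInfo X s ≤ M := by
  have hN := card_pos_of_eq_two_rpow hcard
  have hl := Real.log_pos one_lt_two
  rw [mutualInfo_eq, div_le_iff₀ hl, div_le_iff₀ hN, ← log_card_eq hcard, mul_comm]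
  have := Finset.sum_le_card_nsmul X _ _ fun x hx => outputDivergence_le_log_card hx (√s)
  simpa using this

theorem exists_mutualInfo_le_mul (hcard : (X.card : ℝ) = 2 ^ M) :
    ∃ C > 0, ∀ s, 0 ≤ s → mutualInfo X s ≤ C * s := by
  have hN := card_pos_of_eq_two_rpow hcard
  have hl := Real.log_pos one_lt_two
  refine ⟨(∑ x ∈ X, ∑ x' ∈ X, ‖x - x'‖ ^ 2) / X.card / Real.log 2 + 1, by positivity,
    fun s hs => ?_⟩
  rw [add_mul, one_mul]
  refine le_add_of_le_of_nonneg ?_ hs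
  rw [mutualInfo_eq, div_mul_eq_mul_div, div_mul_eq_mul_div]
  gcongr
  rw [Finset.sum_mul]
  refine Finset.sum_le_sum fun x hx => ?_
  have := outputDivergence_le_mul_sq hx (√s)
  rwa [Real.sq_sqrt hs, mul_comm] at this

theorem exists_pos_forall_le {ι : Type*} (t : Finset ι) (f : ι → ℝ) (h : ∀ i ∈ t, 0 < f i) :
    ∃ c > 0, ∀ i ∈ t, c ≤ f i := by
  rcases t.eq_empty_or_nonempty with rfl | ht
  · exact ⟨1, one_pos, by simp⟩
  · obtain ⟨i, hi, hmin⟩ := t.exists_min_image f ht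
    exact ⟨f i, h i hi, hmin⟩

theorem exists_sub_exp_le_mutualInfo (hcard : (X.card : ℝ) = 2 ^ M) :
    ∃ C > 0, ∃ c > 0, ∀ s, 0 ≤ s → M - C * Real.exp (-(c * s)) ≤ mutualInfo X s := by
  have hN := card_pos_of_eq_two_rpow hcard
  have hl := Real.log_pos one_lt_two
  obtain ⟨c, hc, hmin⟩ := exists_pos_forall_le X.offDiag (fun p => ‖p.1 - p.2‖ ^ 2 / 4)
    fun p hp => by
      have := norm_pos_iff.2 (sub_ne_zero.2 (Finset.mem_offDiag.1 hp).2.2)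
      positivity
  refine ⟨2 * X.card / Real.log 2, by positivity, c, hc, fun s hs => ?_⟩
  rw [mutualInfo_eq, le_div_iff₀ hl, sub_mul, ← log_card_eq hcard, le_div_iff₀ hN, mul_comm,
    ← nsmul_eq_mul]
  refine Finset.card_nsmul_le_sum X _ _ fun x hx => ?_
  refine le_trans ?_ (log_card_sub_le_outputDivergence hx (√s))
  have : ∑ x' ∈ X.erase x, Real.exp (-(√s ^ 2 * ‖x - x'‖ ^ 2) / 4) ≤
      X.card * Real.exp (-(c * s)) := by
    refine le_trans (Finset.sum_le_card_nsmul _ _ (Real.exp (-(c * s))) fun x' hx' => ?_) ?_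
    · have h := hmin (x, x') (Finset.mem_offDiag.2
        ⟨hx, Finset.mem_of_mem_erase hx', (Finset.ne_of_mem_erase hx').symm⟩)
      rw [Real.sq_sqrt hs]
      gcongr
      nlinarith
    · rw [nsmul_eq_mul]
      gcongr
      exact Finset.erase_subset _ _
  have h2 : 2 * (X.card : ℝ) / Real.log 2 * Real.exp (-(c * s)) * Real.log 2 =
      2 * (X.card * Real.exp (-(c * s))) := by field_simp
  rw [h2]
  linarith

/-- In the Gibbs inequality the exponentials are expanded to second order. The terms of first order
in `x'` cancel because the constellation has zero mean, and unit energy evaluates the quadratic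
ones. -/
theorem mul_sq_norm_le_outputDivergence (hmean : ∑ x ∈ X, x = 0)
    (henergy : (∑ x ∈ X, ‖x‖ ^ 2) / X.card = 1) {x : ℂ} (hx : x ∈ X) {a t : ℝ}
    (h1 : |t * a| * X.card ≤ 1 / 2) (h2 : t ^ 2 * X.card ≤ 1) :
    (t * a - t ^ 2 - 2 * (t * a) ^ 2) * ‖x‖ ^ 2 ≤ outputDivergence X a x := by
  have hN := card_pos_of_mem hx
  have hsum : ∑ x ∈ X, ‖x‖ ^ 2 = X.card := by rw [div_eq_one_iff_eq hN.ne'] at henergy; exact henergy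
  have hle : ∀ y ∈ X, ‖y‖ ^ 2 ≤ X.card := fun y hy => by
    rw [← hsum]; exact Finset.single_le_sum (f := fun x : ℂ => ‖x‖ ^ 2) (fun _ _ => by positivity) hy
  have hdot : ∑ x' ∈ X, dot x x' = 0 := by
    have hre := congrArg Complex.re hmean
    have him := congrArg Complex.im hmean
    simp only [Complex.re_sum, Complex.im_sum, Complex.zero_re, Complex.zero_im] at hre him
    simp [dot, Finset.sum_add_distrib, ← Finset.mul_sum, hre, him]
  set q := t ^ 2 * ‖x‖ ^ 2 / 4 with hq
  have hq0 : 0 ≤ q := by positivity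
  have hq1 : q ≤ 1 / 4 := by nlinarith [hle x hx, sq_nonneg t]
  refine le_trans ?_ (gibbs_outputDivergence hx a t)
  -- Here `exp z ≤ 1 + z + z²` for `|z| ≤ 1`, with `z = r + q`, `z² ≤ 2r² + 2q²` and `2q² ≤ q`.
  have hexp : ∀ x' ∈ X, Real.exp (t * a * dot x x' + q) ≤
      1 + t * a * dot x x' + 2 * q + 2 * ((t * a) ^ 2 * ‖x‖ ^ 2 * ‖x'‖ ^ 2) := fun x' hx' => by
    have hd : |dot x x'| ≤ X.card := by
      refine abs_le_of_sq_le_sq ?_ hN.le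
      refine (dot_sq_le x x').trans ?_
      rw [sq (X.card : ℝ)]
      exact mul_le_mul (hle x hx) (hle x' hx') (by positivity) hN.le
    have hta : |t * a * dot x x'| ≤ 1 / 2 := by
      rw [abs_mul]
      exact (mul_le_mul_of_nonneg_left hd (abs_nonneg _)).trans h1
    have hz : |t * a * dot x x' + q| ≤ 1 := by
      rw [abs_le] at hta ⊢; constructor <;> linarith
    have h := (abs_le.1 (Real.abs_exp_sub_one_sub_id_le hz)).2
    have h3 : (t * a * dot x x') ^ 2 ≤ (t * a) ^ 2 * ‖x‖ ^ 2 * ‖x'‖ ^ 2 := by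
      rw [mul_pow, mul_assoc]
      exact mul_le_mul_of_nonneg_left (dot_sq_le x x') (sq_nonneg _)
    nlinarith [sq_nonneg (t * a * dot x x' - q)]
  have hmul : ∑ x' ∈ X, (1 / (X.card : ℝ)) * Real.exp (t * a * dot x x' + q) ≤
      1 + 2 * q + 2 * ((t * a) ^ 2 * ‖x‖ ^ 2) := by
    rw [← Finset.mul_sum, one_div, inv_mul_le_iff₀ hN]
    refine (Finset.sum_le_sum hexp).trans (le_of_eq ?_)
    simp only [Finset.sum_add_distrib, ← Finset.mul_sum, hdot, hsum, Finset.sum_const,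
      nsmul_eq_mul]
    ring
  nlinarith [sq_nonneg t, mul_nonneg (sq_nonneg t) (sq_nonneg ‖x‖)]

theorem exists_mul_le_mutualInfo (hcard : (X.card : ℝ) = 2 ^ M) (hmean : ∑ x ∈ X, x = 0)
    (henergy : (∑ x ∈ X, ‖x‖ ^ 2) / X.card = 1) :
    ∃ c > 0, ∀ s, 0 ≤ s → c * (s / (1 + s)) ≤ mutualInfo X s := by
  have hN := card_pos_of_eq_two_rpow hcard
  have hN1 : (1 : ℝ) ≤ X.card := by exact_mod_cast hN
  have hl := Real.log_pos one_lt_two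
  have hsum : ∑ x ∈ X, ‖x‖ ^ 2 = X.card := by rw [div_eq_one_iff_eq hN.ne'] at henergy; exact henergy
  obtain ⟨k, hk⟩ : ∃ k : ℝ, k = 1 / (6 * X.card) := ⟨_, rfl⟩
  have hk0 : 0 < k := by rw [hk]; positivity
  have hkN : k * X.card = 1 / 6 := by rw [hk]; field_simp
  have hk6 : k ≤ 1 / 6 := by nlinarith
  refine ⟨k / 2 / Real.log 2, by positivity, fun s hs => ?_⟩
  set u := s / (1 + s) with hu
  have hu0 : 0 ≤ u := by positivity
  have hu1 : u ≤ 1 := by rw [hu, div_le_one (by positivity)]; linarith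
  -- With `u = s / (1 + s)`, this `t` makes the linear gain `t * √s` equal to `k * u` while both
  -- quadratic losses are of order `k² * u`; the total `k * u * (1 - 3 * k)` is at least `k * u / 2`
  -- as `k ≤ 1 / 6`.
  obtain ⟨t, ht⟩ : ∃ t : ℝ, t = k * (√s / (1 + s)) := ⟨_, rfl⟩
  have hta : t * √s = k * u := by
    rw [ht, hu, mul_assoc, div_mul_eq_mul_div, Real.mul_self_sqrt hs]
  have ht2 : t ^ 2 ≤ k ^ 2 * u := by
    rw [ht, mul_pow, div_pow, Real.sq_sqrt hs, hu]
    refine mul_le_mul_of_nonneg_left ?_ (sq_nonneg k)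
    gcongr
    nlinarith
  rw [mutualInfo_eq, div_mul_eq_mul_div]
  gcongr
  rw [le_div_iff₀ hN, ← hsum, Finset.mul_sum]
  refine Finset.sum_le_sum fun x hx => ?_
  refine le_trans ?_ (mul_sq_norm_le_outputDivergence hmean henergy hx (a := √s) (t := t) ?_ ?_)
  · refine mul_le_mul_of_nonneg_right ?_ (sq_nonneg _)
    rw [hta]
    have h1 : (k * u) ^ 2 ≤ k ^ 2 * u := by
      rw [mul_pow]; exact mul_le_mul_of_nonneg_left (by nlinarith) (sq_nonneg k)
    have h2 : k ^ 2 * u ≤ 1 / 6 * (k * u) := by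
      rw [sq, mul_assoc]; exact mul_le_mul_of_nonneg_right hk6 (by positivity)
    linarith
  · rw [hta, abs_of_nonneg (by positivity)]; nlinarith
  · have : k ^ 2 * u ≤ k * 1 := by
      rw [sq, mul_assoc]; exact mul_le_mul_of_nonneg_left (by nlinarith) hk0.le
    nlinarith

end

/-! ### Small-ball and tail estimates for Gaussian vectors. -/

theorem gaussianReal_real_eq_integral {v : ℝ≥0} (hv : v ≠ 0) (s : Set ℝ) :
    (gaussianReal 0 v).real s = ∫ x in s, gaussianPDFReal 0 v x := by
  rw [measureReal_def, gaussianReal_apply_eq_integral _ hv, ENNReal.toReal_ofReal]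
  exact integral_nonneg fun x => gaussianPDFReal_nonneg _ _ _

theorem gaussianReal_real_Icc_le {v : ℝ≥0} (hv : v ≠ 0) (b : ℝ) {ρ : ℝ} (hρ : 0 ≤ ρ) :
    (gaussianReal 0 v).real (Set.Icc (b - ρ) (b + ρ)) ≤ (√(2 * Real.pi * v))⁻¹ * (2 * ρ) := by
  rw [gaussianReal_real_eq_integral hv]
  have h := setIntegral_mono_on (μ := volume) (s := Set.Icc (b - ρ) (b + ρ))
    (f := gaussianPDFReal 0 v) (g := fun _ => (√(2 * Real.pi * v))⁻¹)
    (integrable_gaussianPDFReal 0 v).integrableOn (continuous_const.integrableOn_Icc)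
    measurableSet_Icc fun x _ => by
      rw [gaussianPDFReal]
      refine mul_le_of_le_one_right (by positivity) (Real.exp_le_one_iff.2 ?_)
      rw [neg_div]
      exact neg_nonpos.2 (by positivity)
  refine h.trans (le_of_eq ?_)
  rw [setIntegral_const, Real.volume_real_Icc_of_le (by linarith), smul_eq_mul]
  ring

theorem le_gaussianReal_real_Icc {v : ℝ≥0} (hv : v ≠ 0) (b : ℝ) {ρ : ℝ} (hρ : 0 ≤ ρ)
    (h8 : ∀ x ∈ Set.Icc (b - ρ) (b + ρ), x ^ 2 ≤ 8 * v) :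
    (√(2 * Real.pi * v))⁻¹ * Real.exp (-4) * (2 * ρ) ≤
      (gaussianReal 0 v).real (Set.Icc (b - ρ) (b + ρ)) := by
  rw [gaussianReal_real_eq_integral hv]
  have hv' : (0 : ℝ) < v := by positivity
  have h := setIntegral_mono_on (μ := volume) (s := Set.Icc (b - ρ) (b + ρ))
    (g := gaussianPDFReal 0 v) (f := fun _ => (√(2 * Real.pi * v))⁻¹ * Real.exp (-4))
    continuous_const.integrableOn_Icc (integrable_gaussianPDFReal 0 v).integrableOn measurableSet_Icc fun x hx => by
      rw [gaussianPDFReal]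
      gcongr
      rw [le_div_iff₀ (by positivity), sub_zero]
      linarith [h8 x hx]
  refine le_trans (le_of_eq ?_) h
  rw [setIntegral_const, Real.volume_real_Icc_of_le (by linarith), smul_eq_mul]
  ring

theorem hasSubgaussianMGF_id_gaussianReal (v : ℝ≥0) :
    HasSubgaussianMGF id v (gaussianReal 0 v) where
  integrable_exp_mul t := integrable_exp_mul_gaussianReal t
  mgf_le t := by rw [mgf_id_gaussianReal]; simp

theorem gaussianReal_real_abs_ge_le (v : ℝ≥0) {t : ℝ} (ht : 0 ≤ t) :
    (gaussianReal 0 v).real {x | t ≤ |x|} ≤ 2 * Real.exp (-t ^ 2 / (2 * v)) := by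
  have h1 := (hasSubgaussianMGF_id_gaussianReal v).measure_ge_le ht
  have h2 := (hasSubgaussianMGF_id_gaussianReal v).neg.measure_ge_le ht
  have hs : {x : ℝ | t ≤ |x|} = {x | t ≤ id x} ∪ {x | t ≤ (-id) x} := by
    ext x; simp [le_abs]
  rw [hs]
  exact (measureReal_union_le _ _).trans (by linarith)

/-- The closed square with centre `b` and half side `ρ`. -/
def square (b : ℂ) (ρ : ℝ) : Set ℂ := {z | |z.re - b.re| ≤ ρ ∧ |z.im - b.im| ≤ ρ}

theorem measurableSet_square (b : ℂ) (ρ : ℝ) : MeasurableSet (square b ρ) := by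
  unfold square
  refine MeasurableSet.inter ?_ ?_
  · exact measurableSet_le (f := fun z : ℂ => |z.re - b.re|) (by fun_prop) measurable_const
  · exact measurableSet_le (f := fun z : ℂ => |z.im - b.im|) (by fun_prop) measurable_const

theorem complexGaussian_real_square (v : ℝ≥0) (b : ℂ) (ρ : ℝ) :
    (complexGaussian v).real (square b ρ) =
      (gaussianReal 0 (v / 2)).real (Set.Icc (b.re - ρ) (b.re + ρ)) *
      (gaussianReal 0 (v / 2)).real (Set.Icc (b.im - ρ) (b.im + ρ)) := by
  rw [complexGaussian, map_measureReal_apply (MeasurableEquiv.measurable _)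
    (measurableSet_square b ρ), ← measureReal_prod_prod]
  congr 1
  ext z
  have hre : (Complex.measurableEquivRealProd.symm z).re = z.1 := rfl
  have him : (Complex.measurableEquivRealProd.symm z).im = z.2 := rfl
  simp only [square, Set.mem_preimage, Set.mem_ofPred_eq, abs_le, Set.mem_prod, Set.mem_Icc, hre,
    him]
  constructor
  · rintro ⟨⟨h1, h2⟩, h3, h4⟩
    refine ⟨⟨?_, ?_⟩, ?_, ?_⟩ <;> linarith
  · rintro ⟨⟨h1, h2⟩, h3, h4⟩
    refine ⟨⟨?_, ?_⟩, ?_, ?_⟩ <;> linarith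

theorem inv_sqrt_mul_self {v : ℝ≥0} :
    (√(2 * Real.pi * (v / 2 : ℝ≥0)))⁻¹ * (√(2 * Real.pi * (v / 2 : ℝ≥0)))⁻¹ =
      (Real.pi * v)⁻¹ := by
  rw [← mul_inv, Real.mul_self_sqrt (by positivity)]
  push_cast
  congr 1; ring

theorem complexGaussian_real_square_le {v : ℝ≥0} (hv : v ≠ 0) (b : ℂ) {ρ : ℝ} (hρ : 0 ≤ ρ) :
    (complexGaussian v).real (square b ρ) ≤ 2 * ρ ^ 2 / v := by
  have hv2 : v / 2 ≠ 0 := by positivity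
  have hv' : (0 : ℝ) < v := by positivity
  rw [complexGaussian_real_square]
  refine (mul_le_mul (gaussianReal_real_Icc_le hv2 _ hρ) (gaussianReal_real_Icc_le hv2 _ hρ)
    measureReal_nonneg (by positivity)).trans ?_
  rw [mul_mul_mul_comm, inv_sqrt_mul_self, inv_mul_eq_div]
  rw [div_le_div_iff₀ (by positivity) hv']
  nlinarith [Real.pi_gt_three, mul_nonneg (mul_nonneg hρ hρ) hv'.le]

/-- Within two multiples of `√v` in each coordinate the density is comparable to `1 / v`. Off-centre
squares are allowed because the estimation error will have to hit the negative of the estimate. -/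
theorem le_complexGaussian_real_square {v : ℝ≥0} (hv : v ≠ 0) {b : ℂ} {ρ : ℝ} (hρ : 0 ≤ ρ)
    (hρv : ρ ≤ √v) (hre : |b.re| ≤ √v) (him : |b.im| ≤ √v) :
    Real.exp (-8) * ρ ^ 2 / v ≤ (complexGaussian v).real (square b ρ) := by
  have hv2 : v / 2 ≠ 0 := by positivity
  have hv' : (0 : ℝ) < v := by positivity
  have hb : ∀ c : ℝ, |c| ≤ √v → ∀ x ∈ Set.Icc (c - ρ) (c + ρ), x ^ 2 ≤ 8 * (v / 2 : ℝ≥0) := by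
    intro c hc x hx
    have h2 : |x| ≤ 2 * √v := by
      rw [abs_le] at hc ⊢
      constructor <;> linarith [hx.1, hx.2]
    have := pow_le_pow_left₀ (abs_nonneg x) h2 2
    rw [sq_abs, mul_pow, Real.sq_sqrt hv'.le] at this
    push_cast; linarith
  rw [complexGaussian_real_square]
  refine le_trans ?_ (mul_le_mul (le_gaussianReal_real_Icc hv2 _ hρ (hb _ hre))
    (le_gaussianReal_real_Icc hv2 _ hρ (hb _ him)) (by positivity) measureReal_nonneg)
  have he : Real.exp (-8) = Real.exp (-4) * Real.exp (-4) := by rw [← Real.exp_add]; norm_num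
  have e0 : (√(2 * Real.pi * (v / 2 : ℝ≥0)))⁻¹ * Real.exp (-4) * (2 * ρ) *
      ((√(2 * Real.pi * (v / 2 : ℝ≥0)))⁻¹ * Real.exp (-4) * (2 * ρ)) =
      (Real.pi * v)⁻¹ * (Real.exp (-8) * (4 * ρ ^ 2)) := by
    rw [← inv_sqrt_mul_self, he]; ring
  rw [e0, inv_mul_eq_div, div_le_div_iff₀ hv' (by positivity)]
  nlinarith [Real.pi_le_four, mul_nonneg (mul_nonneg (Real.exp_pos (-8)).le (sq_nonneg ρ)) hv'.le]

theorem complexGaussian_real_normSq_ge_le (v : ℝ≥0) {t : ℝ} (ht : 0 ≤ t) :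
    (complexGaussian v).real {z | t ≤ ‖z‖ ^ 2} ≤ 4 * Real.exp (-t / (2 * v)) := by
  have ht2 : 0 ≤ √(t / 2) := Real.sqrt_nonneg _
  have hm : MeasurableSet {z : ℂ | t ≤ ‖z‖ ^ 2} :=
    measurableSet_le measurable_const (by fun_prop)
  rw [complexGaussian, map_measureReal_apply (MeasurableEquiv.measurable _) hm]
  have hsub : Complex.measurableEquivRealProd.symm ⁻¹' {z : ℂ | t ≤ ‖z‖ ^ 2} ⊆
      ({x | √(t / 2) ≤ |x|} ×ˢ Set.univ) ∪ (Set.univ ×ˢ {x | √(t / 2) ≤ |x|}) := by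
    intro z hz
    have hz' : t ≤ z.1 ^ 2 + z.2 ^ 2 := by
      simpa [norm_sq_eq, Complex.measurableEquivRealProd] using hz
    simp only [Set.mem_union, Set.mem_prod, Set.mem_ofPred_eq, Set.mem_univ, and_true, true_and]
    rcases le_total (z.1 ^ 2) (z.2 ^ 2) with h | h
    · right; exact Real.sqrt_le_iff.2 ⟨abs_nonneg _, by rw [sq_abs]; linarith⟩
    · left; exact Real.sqrt_le_iff.2 ⟨abs_nonneg _, by rw [sq_abs]; linarith⟩
  have h := gaussianReal_real_abs_ge_le (v / 2) ht2
  have e : -√(t / 2) ^ 2 / (2 * ((v / 2 : ℝ≥0) : ℝ)) = -t / (2 * v) := by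
    rw [Real.sq_sqrt (by positivity)]; push_cast
    rw [show 2 * ((v : ℝ) / 2) = v by ring, ← neg_div, div_div]
  rw [e] at h
  refine (measureReal_mono hsub).trans ((measureReal_union_le _ _).trans ?_)
  rw [measureReal_prod_prod, measureReal_prod_prod, probReal_univ]
  linarith

section
variable {B m : ℕ}

theorem gaussianBlocks_real_forall_mem (v : ℝ≥0) (A : Finset (Fin B))
    (U : Fin B → Fin m → Set ℂ) :
    (gaussianBlocks B m v).real {h | ∀ i ∈ A, ∀ j, h i j ∈ U i j} =
      ∏ i ∈ A, ∏ j, (complexGaussian v).real (U i j) := by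
  classical
  have hs : {h : Fin B → Fin m → ℂ | ∀ i ∈ A, ∀ j, h i j ∈ U i j} =
      Set.univ.pi fun i => if i ∈ A then Set.univ.pi (U i) else Set.univ := by
    ext h
    simp only [Set.mem_ofPred_eq, Set.mem_pi, Set.mem_univ, true_imp_iff]
    refine forall_congr' fun i => ?_
    by_cases hi : i ∈ A <;> simp [hi]
  rw [hs, measureReal_def, gaussianBlocks, Measure.pi_pi, ENNReal.toReal_prod,
    ← Finset.prod_subset (Finset.subset_univ A)]
  · refine Finset.prod_congr rfl fun i hi => ?_
    rw [if_pos hi, Measure.pi_pi, ENNReal.toReal_prod]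
    rfl
  · intro i _ hi
    rw [if_neg hi, measure_univ, ENNReal.toReal_one]

theorem gaussianBlocks_real_forall_mem_le (v : ℝ≥0) (A : Finset (Fin B))
    (U : Fin B → Fin m → Set ℂ) {q : ℝ} (h : ∀ i j, (complexGaussian v).real (U i j) ≤ q) :
    (gaussianBlocks B m v).real {h | ∀ i ∈ A, ∀ j, h i j ∈ U i j} ≤ q ^ (m * A.card) := by
  rw [gaussianBlocks_real_forall_mem]
  refine (Finset.prod_le_prod (fun i _ => Finset.prod_nonneg fun _ _ => measureReal_nonneg)
    fun i _ => Finset.prod_le_prod (fun _ _ => measureReal_nonneg) fun j _ => h i j).trans ?_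
  simp [pow_mul]

theorem le_gaussianBlocks_real_forall_mem (v : ℝ≥0) (A : Finset (Fin B))
    (U : Fin B → Fin m → Set ℂ) {q : ℝ} (hq : 0 ≤ q)
    (h : ∀ i ∈ A, ∀ j, q ≤ (complexGaussian v).real (U i j)) :
    q ^ (m * A.card) ≤ (gaussianBlocks B m v).real {h | ∀ i ∈ A, ∀ j, h i j ∈ U i j} := by
  rw [gaussianBlocks_real_forall_mem]
  refine le_trans ?_ (Finset.prod_le_prod (fun i _ => Finset.prod_nonneg fun _ _ => hq)
    fun i hi => Finset.prod_le_prod (fun _ _ => hq) fun j _ => h i hi j)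
  simp [pow_mul]

theorem gains_nonneg (h : Fin B → Fin m → ℂ) (i : Fin B) : 0 ≤ gains h i :=
  Finset.sum_nonneg fun _ _ => by positivity

theorem measurable_gains : Measurable (gains : (Fin B → Fin m → ℂ) → Fin B → ℝ) := by
  unfold gains
  fun_prop

theorem mem_square_of_gains_le {h : Fin B → Fin m → ℂ} {i : Fin B} {x : ℝ}
    (hx : gains h i ≤ x) (j : Fin m) : h i j ∈ square 0 (√x) := by
  have h1 : ‖h i j‖ ^ 2 ≤ x := (Finset.single_le_sum (f := fun j => ‖h i j‖ ^ 2)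
    (fun _ _ => by positivity) (Finset.mem_univ j)).trans hx
  rw [norm_sq_eq] at h1
  simp only [square, Set.mem_ofPred_eq, Complex.zero_re, Complex.zero_im, sub_zero]
  exact ⟨Real.abs_le_sqrt (by nlinarith), Real.abs_le_sqrt (by nlinarith)⟩

theorem gains_le_of_mem_square {h : Fin B → Fin m → ℂ} {i : Fin B} {ρ : ℝ}
    (hs : ∀ j, h i j ∈ square 0 ρ) : gains h i ≤ 2 * m * ρ ^ 2 := by
  have : gains h i ≤ ∑ _j : Fin m, 2 * ρ ^ 2 := Finset.sum_le_sum fun j _ => by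
    have := hs j
    simp only [square, Set.mem_ofPred_eq, Complex.zero_re, Complex.zero_im, sub_zero] at this
    rw [norm_sq_eq]
    have h1 := pow_le_pow_left₀ (abs_nonneg _) this.1 2
    have h2 := pow_le_pow_left₀ (abs_nonneg _) this.2 2
    rw [sq_abs] at h1 h2
    linarith
  refine this.trans (le_of_eq ?_)
  simp; ring

theorem gaussianBlocks_real_gains_le_le {v : ℝ≥0} (hv : v ≠ 0) (A : Finset (Fin B)) {x : ℝ}
    (hx : 0 ≤ x) :
    (gaussianBlocks B m v).real {h | ∀ i ∈ A, gains h i ≤ x} ≤ (2 * x / v) ^ (m * A.card) := by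
  have hsub : {h : Fin B → Fin m → ℂ | ∀ i ∈ A, gains h i ≤ x} ⊆
      {h | ∀ i ∈ A, ∀ j, h i j ∈ square 0 (√x)} := fun h hh i hi j =>
    mem_square_of_gains_le (hh i hi) j
  refine (measureReal_mono hsub).trans
    (gaussianBlocks_real_forall_mem_le v A (fun _ _ => square 0 (√x)) fun i j => ?_)
  have := complexGaussian_real_square_le hv 0 (Real.sqrt_nonneg x)
  rwa [Real.sq_sqrt hx] at this

theorem gaussianBlocks_real_gain_ge_le (v : ℝ≥0) (hm : 0 < m) (i : Fin B) {t : ℝ} (ht : 0 ≤ t) :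
    (gaussianBlocks B m v).real {h | t ≤ gains h i} ≤ m * (4 * Real.exp (-t / (2 * m * v))) := by
  have hm' : (0 : ℝ) < m := by exact_mod_cast hm
  have hsub : {h : Fin B → Fin m → ℂ | t ≤ gains h i} ⊆
      ⋃ j, {h | t / m ≤ ‖h i j‖ ^ 2} := by
    intro h hh
    by_contra hc
    simp only [Set.mem_iUnion, Set.mem_ofPred_eq, not_exists, not_le] at hc
    have : gains h i < ∑ _j : Fin m, t / m :=
      Finset.sum_lt_sum_of_nonempty ⟨⟨0, hm⟩, Finset.mem_univ _⟩ fun j _ => hc j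
    simp only [Finset.sum_const, Finset.card_univ, Fintype.card_fin, nsmul_eq_mul] at this
    rw [mul_div_cancel₀ _ hm'.ne'] at this
    exact absurd hh (not_le.2 this)
  refine (measureReal_mono hsub).trans ((measureReal_iUnion_fintype_le _).trans ?_)
  have hj : ∀ j : Fin m, (gaussianBlocks B m v).real {h | t / m ≤ ‖h i j‖ ^ 2} ≤
      4 * Real.exp (-t / (2 * m * v)) := fun j => by
    have e1 := measurePreserving_eval
      (fun _ : Fin B => Measure.pi fun _ : Fin m => complexGaussian v) i
    have e2 := (measurePreserving_eval (fun _ : Fin m => complexGaussian v) j).comp e1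
    have hms : MeasurableSet {z : ℂ | t / m ≤ ‖z‖ ^ 2} :=
      measurableSet_le measurable_const (by fun_prop)
    have := e2.measureReal_preimage hms.nullMeasurableSet
    refine le_trans (le_of_eq this) ?_
    refine (complexGaussian_real_normSq_ge_le v (by positivity)).trans (le_of_eq ?_)
    congr 2
    rw [← neg_div, div_div]; congr 1; ring
  refine (Finset.sum_le_sum fun j _ => hj j).trans (le_of_eq ?_)
  simp

end

/-! ### Converse: lower bounds on the outage probability of every allocation. -/

instance isProbabilityMeasure_csitLaw (B m : ℕ) (de snr : ℝ) :
    IsProbabilityMeasure (csitLaw B m de snr) := by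
  unfold csitLaw; infer_instance

theorem mul_measureReal_le_prod {α β : Type*} [MeasurableSpace α] [MeasurableSpace β]
    (μ : Measure α) (ν : Measure β) [IsProbabilityMeasure μ] [IsProbabilityMeasure ν]
    {s : Set (α × β)} (hs : MeasurableSet s) {E : Set α} (hE : MeasurableSet E) {q : ℝ}
    (hq : 0 ≤ q) (h : ∀ x ∈ E, q ≤ ν.real (Prod.mk x ⁻¹' s)) :
    q * μ.real E ≤ (μ.prod ν).real s := by
  have h1 : ENNReal.ofReal q * μ E ≤ (μ.prod ν) s := by
    rw [Measure.prod_apply hs, ← setLIntegral_const]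
    refine (setLIntegral_mono' hE fun x hx => ?_).trans (setLIntegral_le_lintegral E _)
    exact ENNReal.ofReal_le_of_le_toReal (h x hx)
  have h2 := ENNReal.toReal_mono (measure_ne_top _ _) h1
  rwa [ENNReal.toReal_mul, ENNReal.toReal_ofReal hq] at h2

section
variable {B m : ℕ} {de dpeak snr : ℝ} {P : PowerAllocation B}

/-- The blocks outside `A` carry at most `M` bits each, which leaves a positive gap to the rate; by
the linear upper bound at low power, sufficiently weak blocks of `A` cannot fill it. -/
theorem exists_weak_blocks_outage {X : Finset ℂ} {M R : ℝ} (hcard : (X.card : ℝ) = 2 ^ M)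
    (hB : 0 < B) (A : Finset (Fin B)) (hA : ((B : ℝ) - A.card) * M < B * R) :
    ∃ s₀ > 0, s₀ ≤ 1 ∧ ∀ q : Fin B → ℝ, (∀ i ∈ A, 0 ≤ q i ∧ q i ≤ s₀) →
      (∑ i, mutualInfo X (q i)) / B < R := by
  obtain ⟨C, hC, hle⟩ := exists_mutualInfo_le_mul hcard
  have hB' : (0 : ℝ) < B := by exact_mod_cast hB
  set gap := B * R - ((B : ℝ) - A.card) * M with hgap
  have hgap0 : 0 < gap := by linarith
  refine ⟨min 1 (gap / (2 * (A.card + 1) * C)), by positivity, min_le_left _ _, fun q hq => ?_⟩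
  rw [div_lt_iff₀ hB', mul_comm, ← Finset.sum_add_sum_compl A]
  have h1 : ∑ i ∈ A, mutualInfo X (q i) ≤ A.card * (gap / (2 * (A.card + 1))) := by
    rw [← nsmul_eq_mul]
    refine Finset.sum_le_card_nsmul _ _ _ fun i hi => (hle _ (hq i hi).1).trans ?_
    refine (mul_le_mul_of_nonneg_left ((hq i hi).2.trans (min_le_right _ _)) hC.le).trans
      (le_of_eq ?_)
    field_simp
  have h2 : ∑ i ∈ Aᶜ, mutualInfo X (q i) ≤ ((B : ℝ) - A.card) * M := by
    refine (Finset.sum_le_card_nsmul _ _ _ fun i _ => mutualInfo_le hcard _).trans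
      (le_of_eq ?_)
    rw [Finset.card_compl, nsmul_eq_mul, Fintype.card_fin, Nat.cast_sub]
    simpa using Finset.card_le_univ A
  have h3 : (A.card : ℝ) * (gap / (2 * (A.card + 1))) < gap := by
    rw [mul_div_assoc', div_lt_iff₀ (by positivity)]
    nlinarith [show (0 : ℝ) ≤ A.card from by positivity]
  linarith

theorem le_mul_avgPower (hB : 0 < B) (hP : ∀ g i, 0 ≤ P g i) (g : Fin B → ℝ) (i : Fin B) :
    P g i ≤ B * avgPower P g := by
  have hB' : (B : ℝ) ≠ 0 := by positivity
  rw [avgPower, mul_div_cancel₀ _ hB']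
  exact Finset.single_le_sum (fun j _ => hP g j) (Finset.mem_univ i)

theorem avgPower_nonneg (hP : ∀ g i, 0 ≤ P g i) (g : Fin B → ℝ) : 0 ≤ avgPower P g :=
  div_nonneg (Finset.sum_nonneg fun i _ => hP g i) (by positivity)

/-- On blocks whose channel coefficients are small and whose normalized total power is bounded, the
received power is small. -/
theorem received_power_le (hB : 0 < B) (hm : 0 < m) (hP : ∀ g i, 0 ≤ P g i) {g : Fin B → ℝ}
    {h : Fin B → Fin m → ℂ} {i : Fin B} {T s₀ ρ : ℝ} (hT : 0 < T) (hg : avgPower P g ≤ T)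
    (hs : ∀ j, h i j ∈ square 0 ρ) (hρ : ρ ^ 2 ≤ s₀ / (2 * m * B * T)) :
    0 ≤ P g i * gains h i ∧ P g i * gains h i ≤ s₀ := by
  have hB' : (0 : ℝ) < B := by positivity
  have hm' : (0 : ℝ) < m := by positivity
  refine ⟨mul_nonneg (hP g i) (gains_nonneg h i), ?_⟩
  have h1 : P g i ≤ B * T :=
    (le_mul_avgPower hB hP g i).trans (mul_le_mul_of_nonneg_left hg hB'.le)
  refine (mul_le_mul h1 (gains_le_of_mem_square hs) (gains_nonneg h i) (by positivity)).trans ?_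
  rw [le_div_iff₀ (by positivity)] at hρ
  linarith

theorem measurableSet_forall_mem_square (A : Finset (Fin B)) (ρ : ℝ) :
    MeasurableSet {h : Fin B → Fin m → ℂ | ∀ i ∈ A, ∀ j, h i j ∈ square 0 ρ} := by
  have : {h : Fin B → Fin m → ℂ | ∀ i ∈ A, ∀ j, h i j ∈ square 0 ρ} =
      ⋂ i ∈ A, ⋂ j, (fun h : Fin B → Fin m → ℂ => h i j) ⁻¹' square 0 ρ := by
    ext h; simp
  rw [this]
  refine Finset.measurableSet_biInter _ fun i _ => MeasurableSet.iInter fun j => ?_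
  exact (show Measurable fun h : Fin B → Fin m → ℂ => h i j by fun_prop) (measurableSet_square _ _)

/-- The powers are at most `B * snr ^ dpeak`, so gains of order `snr ^ (-dpeak)` on `A` suffice for
an outage. Only the law of the true channel matters. -/
theorem le_outageProb_of_peak {X : Finset ℂ} {M R : ℝ} (hcard : (X.card : ℝ) = 2 ^ M)
    (hB : 0 < B) (hm : 0 < m) (hde : 0 ≤ de) (hdpeak : 0 ≤ dpeak) (A : Finset (Fin B))
    (hA : ((B : ℝ) - A.card) * M < B * R) :
    ∃ c > 0, ∀ snr, 1 ≤ snr → ∀ P, Admissible B m de dpeak snr P →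
      c * (snr ^ (-dpeak)) ^ (m * A.card) ≤ outageProb B m X R de snr P := by
  obtain ⟨s₀, hs₀, hs₁, hout⟩ := exists_weak_blocks_outage hcard hB A hA
  have hB' : (1 : ℝ) ≤ B := by exact_mod_cast hB
  have hm' : (1 : ℝ) ≤ m := by exact_mod_cast hm
  refine ⟨(Real.exp (-8) * (s₀ / (2 * m * B))) ^ (m * A.card), by positivity,
    fun snr hsnr P hP => ?_⟩
  have hsnr0 : 0 < snr := by linarith
  have hT : 1 ≤ snr ^ dpeak := Real.one_le_rpow hsnr hdpeak
  obtain ⟨ρ, hρ⟩ : ∃ ρ, ρ = √(s₀ / (2 * m * B * snr ^ dpeak)) := ⟨_, rfl⟩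
  have hρ2 : ρ ^ 2 = s₀ / (2 * m * B * snr ^ dpeak) := by
    rw [hρ, Real.sq_sqrt (by positivity)]
  have hmB : (1 : ℝ) ≤ m * B := one_le_mul_of_one_le_of_one_le hm' hB'
  have hρ0 : 0 ≤ ρ := by rw [hρ]; positivity
  have hρ1 : ρ ≤ 1 := by
    have : ρ ^ 2 ≤ 1 := by
      rw [hρ2, div_le_one (by positivity)]
      nlinarith [one_le_mul_of_one_le_of_one_le hmB hT]
    nlinarith
  have hsub : (fun z : (Fin B → Fin m → ℂ) × (Fin B → Fin m → ℂ) => z.1 + z.2) ⁻¹'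
      {h | ∀ i ∈ A, ∀ j, h i j ∈ square 0 ρ} ⊆
      {z | (∑ i, mutualInfo X (P (gains z.1) i * gains (z.1 + z.2) i)) / B < R} := by
    intro z hz
    refine hout _ fun i hi => ?_
    exact received_power_le hB hm hP.nonneg (by positivity) (hP.peak _) (hz i hi) hρ2.le
  refine le_trans ?_ (measureReal_mono hsub)
  rw [← map_measureReal_apply (by fun_prop) (measurableSet_forall_mem_square A ρ),
    map_add_csitLaw B m hde hsnr]
  refine le_trans (le_of_eq ?_) (le_gaussianBlocks_real_forall_mem 1 A (fun _ _ => square 0 ρ)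
    (q := Real.exp (-8) * ρ ^ 2) (by positivity) fun i _ j => ?_)
  · rw [← mul_pow, hρ2, Real.rpow_neg hsnr0.le]
    congr 1
    field_simp
  · have := le_complexGaussian_real_square (v := 1) one_ne_zero (b := 0) hρ0 (by simpa using hρ1)
      (by simp) (by simp)
    simpa using this

theorem csitNoiseVar_coe (hsnr : 0 < snr) : (csitNoiseVar de snr : ℝ) = snr ^ (-de) :=
  Real.coe_toNNReal _ (by positivity)

theorem eventually_csitNoiseVar_le_half (hde : 0 < de) :
    ∀ᶠ snr : ℝ in atTop, (csitNoiseVar de snr : ℝ) ≤ 1 / 2 := by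
  filter_upwards [(tendsto_rpow_neg_atTop hde).eventually_le_const (show (0 : ℝ) < 1 / 2 by norm_num),
    eventually_gt_atTop 0] with snr h h0
  rwa [csitNoiseVar_coe h0]

/-- With `ε` the error variance, the estimate is of order `√ε` on `A` with probability about `ε ^
k`, and the power is then mostly at most `T ≈ snr / ε ^ k`. Given such an estimate, the error brings
the true channel within `ρ ≈ T ^ (-1/2)` of zero with probability about `(ρ² / ε) ^ k`. In the
product the powers of `ε` cancel and about `T ^ (-k)` remains. -/
theorem le_outageProb_of_average {X : Finset ℂ} {M R : ℝ} (hcard : (X.card : ℝ) = 2 ^ M)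
    (hB : 0 < B) (hm : 0 < m) (hde : 0 < de) (A : Finset (Fin B)) (hA0 : 0 < A.card)
    (hA : ((B : ℝ) - A.card) * M < B * R) :
    ∃ c > 0, ∀ᶠ snr in atTop, ∀ P, Admissible B m de dpeak snr P →
      c * (snr ^ (-(1 + (m * A.card : ℕ) * de))) ^ (m * A.card) ≤
        outageProb B m X R de snr P := by
  obtain ⟨s₀, hs₀, hs₁, hout⟩ := exists_weak_blocks_outage hcard hB A hA
  have hB' : (1 : ℝ) ≤ B := by exact_mod_cast hB
  have hm' : (1 : ℝ) ≤ m := by exact_mod_cast hm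
  have hmB : (1 : ℝ) ≤ m * B := one_le_mul_of_one_le_of_one_le hm' hB'
  obtain ⟨k, hk⟩ : ∃ k, k = m * A.card := ⟨_, rfl⟩
  have hk0 : 0 < k := by rw [hk]; positivity
  rw [← hk]
  obtain ⟨b, hb⟩ : ∃ b, b = Real.exp (-8) := ⟨_, rfl⟩
  have hb0 : 0 < b := by rw [hb]; positivity
  have hb1 : b ≤ 1 := by rw [hb, Real.exp_le_one_iff]; norm_num
  refine ⟨(b * (s₀ / (4 * m * B)) * b ^ k) ^ k * (b ^ k / 2), by positivity, ?_⟩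
  filter_upwards [eventually_csitNoiseVar_le_half hde, eventually_ge_atTop 1] with snr hε2 hsnr P hP
  have hsnr0 : 0 < snr := by linarith
  obtain ⟨ε, hε⟩ : ∃ ε, ε = csitNoiseVar de snr := ⟨_, rfl⟩
  have hεr : (ε : ℝ) = snr ^ (-de) := by rw [hε, csitNoiseVar_coe hsnr0]
  have hε0 : (0 : ℝ) < ε := by rw [hεr]; positivity
  rw [← hε] at hε2
  have hv : ((1 - ε : ℝ≥0) : ℝ) = 1 - ε :=
    NNReal.coe_sub (by rw [← NNReal.coe_le_coe, NNReal.coe_one]; linarith)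
  have hv0 : (0 : ℝ) < (1 - ε : ℝ≥0) := by rw [hv]; linarith
  set μ := gaussianBlocks B m (1 - ε) with hμ
  set ν := gaussianBlocks B m ε with hν
  have hlaw : csitLaw B m de snr = μ.prod ν := by rw [csitLaw, ← hε]
  set p := (b * ε) ^ k with hp
  have hp0 : 0 < p := by positivity
  have hpε : p ≤ ε := by
    have h1 : b * ε ≤ 1 * ε := mul_le_mul_of_nonneg_right hb1 hε0.le
    refine (pow_le_of_le_one (by positivity) (by linarith) hk0.ne').trans (by linarith)
  set E := {h : Fin B → Fin m → ℂ | ∀ i ∈ A, ∀ j, h i j ∈ square 0 (√ε)} with hE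
  have hEm : MeasurableSet E := measurableSet_forall_mem_square A _
  have hEp : p ≤ μ.real E := by
    rw [hp, hk]
    refine le_gaussianBlocks_real_forall_mem _ A (fun _ _ => square 0 (√ε)) (by positivity)
      fun i _ j => le_trans ?_ (le_complexGaussian_real_square (b := 0)
        (NNReal.coe_ne_zero.1 hv0.ne') (Real.sqrt_nonneg _) ?_ (by simp) (by simp))
    · rw [Real.sq_sqrt hε0.le, ← hb, le_div_iff₀ hv0]
      refine mul_le_of_le_one_right (by positivity) ?_
      rw [hv]; linarith
    · exact Real.sqrt_le_sqrt (by rw [hv]; linarith)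
  -- The factor `2` lets Markov's inequality discard at most half of the probability `p` of `E`.
  obtain ⟨T, hT⟩ : ∃ T, T = 2 * snr / p := ⟨_, rfl⟩
  have hT0 : 0 < T := by rw [hT]; positivity
  have hTε : 1 / T ≤ ε := by
    rw [hT, one_div_div, div_le_iff₀ (by positivity)]
    nlinarith
  set F := {h : Fin B → Fin m → ℂ | T ≤ avgPower P (gains h)} with hF
  have hmeas : Measurable fun h : Fin B → Fin m → ℂ => avgPower P (gains h) := by
    have := hP.measurable.comp (measurable_gains (B := B) (m := m))
    unfold avgPower
    exact (Finset.measurable_fun_sum _ fun i _ => (measurable_pi_apply i).comp this).div_const _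
  have hFm : MeasurableSet F := measurableSet_le measurable_const hmeas
  have hint : Integrable (fun h : Fin B → Fin m → ℂ => avgPower P (gains h)) μ :=
    (integrable_const (snr ^ dpeak)).mono' hmeas.aestronglyMeasurable (ae_of_all _ fun h => by
      rw [Real.norm_of_nonneg (avgPower_nonneg hP.nonneg _)]; exact hP.peak _)
  have hFp : μ.real F ≤ p / 2 := by
    have h1 := mul_meas_ge_le_integral_of_nonneg
      (ae_of_all μ fun h => avgPower_nonneg hP.nonneg (gains h)) hint T
    have h2 := hP.average
    rw [hlaw, integral_fun_fst (fun h => avgPower P (gains h)), probReal_univ, one_smul] at h2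
    have h3 : T * μ.real F ≤ snr := h1.trans h2
    rw [hT, div_mul_eq_mul_div, div_le_iff₀ hp0] at h3
    nlinarith
  have hEF : p / 2 ≤ μ.real (E \ F) := by
    have : μ.real E ≤ μ.real (E \ F) + μ.real F := by
      refine (measureReal_mono ?_).trans (measureReal_union_le _ _)
      intro x hx
      by_cases hxF : x ∈ F
      · exact Or.inr hxF
      · exact Or.inl ⟨hx, hxF⟩
    linarith
  obtain ⟨ρ, hρ⟩ : ∃ ρ, ρ = √(s₀ / (2 * m * B * T)) := ⟨_, rfl⟩
  have hρ2 : ρ ^ 2 = s₀ / (2 * m * B * T) := by rw [hρ, Real.sq_sqrt (by positivity)]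
  have hρ0 : 0 ≤ ρ := by rw [hρ]; positivity
  have hρε : ρ ≤ √ε := by
    rw [hρ]
    refine Real.sqrt_le_sqrt (le_trans ?_ hTε)
    rw [div_le_div_iff₀ (by positivity) hT0]
    nlinarith [mul_le_mul_of_nonneg_right hmB hT0.le]
  set O := {z : (Fin B → Fin m → ℂ) × (Fin B → Fin m → ℂ) | z.1 ∈ E \ F} ∩
    (fun z : (Fin B → Fin m → ℂ) × (Fin B → Fin m → ℂ) => z.1 + z.2) ⁻¹'
      {h | ∀ i ∈ A, ∀ j, h i j ∈ square 0 ρ} with hO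
  have hOm : MeasurableSet O := MeasurableSet.inter (measurable_fst (hEm.diff hFm))
    ((show Measurable fun z : (Fin B → Fin m → ℂ) × (Fin B → Fin m → ℂ) => z.1 + z.2 by
      fun_prop) (measurableSet_forall_mem_square A ρ))
  have hsub : O ⊆ {z | (∑ i, mutualInfo X (P (gains z.1) i * gains (z.1 + z.2) i)) / B < R} := by
    intro z hz
    refine hout _ fun i hi => ?_
    exact received_power_le hB hm hP.nonneg hT0 (not_le.1 hz.1.2).le (hz.2 i hi) hρ2.le
  refine le_trans ?_ (measureReal_mono hsub)
  rw [hlaw]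
  have hsec : ∀ x ∈ E \ F, (b * ρ ^ 2 / ε) ^ k ≤ ν.real (Prod.mk x ⁻¹' O) := by
    intro x hx
    -- The error must land in a small square about minus the estimate. On `E` that centre has
    -- coordinates at most `√ε`, so the Gaussian density there is still of order `1 / ε`.
    have hs : {e : Fin B → Fin m → ℂ | ∀ i ∈ A, ∀ j, e i j ∈ square (-x i j) ρ} ⊆
        Prod.mk x ⁻¹' O := by
      intro e he
      refine ⟨hx, fun i hi j => ?_⟩
      have := he i hi j
      simp only [square, Set.mem_ofPred_eq, Complex.neg_re, Complex.neg_im, Pi.add_apply,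
        Complex.add_re, Complex.add_im, Complex.zero_re, Complex.zero_im, sub_zero] at this ⊢
      rwa [sub_neg_eq_add, sub_neg_eq_add, add_comm (e i j).re, add_comm (e i j).im] at this
    refine le_trans ?_ (measureReal_mono hs)
    rw [hk]
    refine le_gaussianBlocks_real_forall_mem ε A (fun i j => square (-x i j) ρ) (by positivity)
      fun i hi j => ?_
    have hxs := hx.1 i hi j
    simp only [square, Set.mem_ofPred_eq, Complex.zero_re, Complex.zero_im, sub_zero] at hxs
    rw [hb]
    exact le_complexGaussian_real_square (NNReal.coe_ne_zero.1 hε0.ne') hρ0 hρε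
      (by simpa using hxs.1) (by simpa using hxs.2)
  refine le_trans ?_ (mul_measureReal_le_prod μ ν hOm (hEm.diff hFm) (by positivity) hsec)
  refine le_trans (le_of_eq ?_) (mul_le_mul_of_nonneg_left hEF (by positivity))
  have hexp : snr ^ (-(1 + (k : ℝ) * de)) = ε ^ k / snr := by
    rw [hεr, ← Real.rpow_natCast, ← Real.rpow_mul hsnr0.le, neg_add, Real.rpow_add hsnr0,
      Real.rpow_neg_one, div_eq_mul_inv, mul_comm]
    congr 2; ring
  have e1 : b * ρ ^ 2 / ε = (b * (s₀ / (4 * m * B)) * b ^ k) * (ε ^ k / snr) / ε := by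
    rw [hρ2, hT, hp, mul_pow]; field_simp; ring
  rw [hexp, e1, hp]
  generalize b * (s₀ / (4 * m * B)) * b ^ k = K
  rw [div_pow _ (ε : ℝ), mul_pow K, mul_pow b]
  field_simp

end

/-! ### Growth comparisons and a sufficient condition for no outage. -/

theorem eventually_const_mul_rpow_le {u w : ℝ} (h : u < w) (C : ℝ) :
    ∀ᶠ S : ℝ in atTop, C * S ^ u ≤ S ^ w := by
  filter_upwards [(tendsto_rpow_atTop (sub_pos.2 h)).eventually_ge_atTop C,
    eventually_gt_atTop 0] with S hS h0
  calc C * S ^ u ≤ S ^ (w - u) * S ^ u := by gcongr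
    _ = S ^ w := by rw [← Real.rpow_add h0, sub_add_cancel]

theorem eventually_const_mul_exp_neg_rpow_le {c δ : ℝ} (hc : 0 < c) (hδ : 0 < δ) (C w : ℝ) :
    ∀ᶠ S : ℝ in atTop, C * Real.exp (-(c * S ^ δ)) ≤ S ^ w := by
  have h := (isLittleO_exp_neg_mul_rpow_atTop hc (w / δ)).comp_tendsto (tendsto_rpow_atTop hδ)
  filter_upwards [(h.const_mul_left C).bound one_pos, eventually_gt_atTop 0] with S hS h0
  simp only [Function.comp_apply, one_mul] at hS
  rw [← Real.rpow_mul h0.le, mul_div_cancel₀ _ hδ.ne', Real.norm_of_nonneg (Real.rpow_nonneg h0.le w)] at hS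
  rw [← neg_mul]
  exact (le_abs_self _).trans hS

/-- If every `d` blocks contain a strong one and no block is exponentially weak, then there is no
outage. -/
theorem exists_strong_blocks_no_outage {X : Finset ℂ} {M R : ℝ} {B d : ℕ}
    (hcard : (X.card : ℝ) = 2 ^ M) (hmean : ∑ x ∈ X, x = 0)
    (henergy : (∑ x ∈ X, ‖x‖ ^ 2) / X.card = 1) (hRM : R < M) (hd : 1 ≤ d) (hdB : d ≤ B)
    (hBR : (B : ℝ) * R ≤ ((B : ℝ) - d + 1) * M) :
    ∃ K > 0, ∃ c > 0, ∀ᶠ t : ℝ in atTop, ∀ q : Fin B → ℝ,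
      (∀ A : Finset (Fin B), A.card = d → ∃ i ∈ A, t < q i) →
      (∀ i, K * Real.exp (-(c * t)) ≤ q i) → R ≤ (∑ i, mutualInfo X (q i)) / B := by
  obtain ⟨C, hC, c, hc, hstrong⟩ := exists_sub_exp_le_mutualInfo hcard
  obtain ⟨c', hc', hweak⟩ := exists_mul_le_mutualInfo hcard hmean henergy
  have hB : 0 < B := by omega
  have hB' : (0 : ℝ) < B := by exact_mod_cast hB
  -- Chosen so that a block with received power at least `κ ≤ 1` carries at least `c' * κ / 2 = B *
  -- η` bits, where `η` bounds the deficit of a strong block.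
  refine ⟨2 * B * C / c', by positivity, c, hc, ?_⟩
  have hlim : Tendsto (fun t : ℝ => Real.exp (-(c * t))) atTop (𝓝 0) :=
    Real.tendsto_exp_neg_atTop_nhds_zero.comp (tendsto_id.const_mul_atTop hc)
  have hlim1 := hlim.const_mul (2 * B * C / c')
  have hlim2 := hlim.const_mul C
  rw [mul_zero] at hlim1 hlim2
  filter_upwards [hlim1.eventually_le_const one_pos, hlim2.eventually_le_const (sub_pos.2 hRM),
    eventually_ge_atTop 0] with t ht1 ht2 ht0 q hq hκ
  set κ := 2 * B * C / c' * Real.exp (-(c * t)) with hκdef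
  set η := C * Real.exp (-(c * t)) with hη
  have hη0 : 0 < η := by positivity
  have hκ0 : 0 < κ := by positivity
  rw [le_div_iff₀ hB', mul_comm]
  have hS : ∀ i, t < q i → M - η ≤ mutualInfo X (q i) := fun i hi => by
    refine le_trans ?_ (hstrong _ (ht0.trans hi.le))
    rw [hη]; gcongr
  have hW : ∀ i, B * η ≤ mutualInfo X (q i) := fun i => by
    have hqi := hκ i
    have hq0 : 0 < q i := hκ0.trans_le hqi
    refine le_trans ?_ (hweak _ hq0.le)
    have h1 : κ / 2 ≤ q i / (1 + q i) := by
      rw [le_div_iff₀ (by positivity)]; nlinarith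
    refine le_trans (le_of_eq ?_) (mul_le_mul_of_nonneg_left h1 hc'.le)
    rw [hκdef, hη]; field_simp
  have hT : B - d + 1 ≤ (Finset.univ.filter fun i => t < q i).card := by
    by_contra hlt
    have hcompl : d ≤ (Finset.univ.filter fun i => ¬ t < q i).card := by
      have := Finset.card_filter_add_card_filter_not (s := (Finset.univ : Finset (Fin B)))
        (fun i => t < q i)
      rw [Finset.card_univ, Fintype.card_fin] at this
      omega
    obtain ⟨A, hA, hAc⟩ := Finset.exists_subset_card_eq hcompl
    obtain ⟨i, hi, hti⟩ := hq A hAc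
    exact (Finset.mem_filter.1 (hA hi)).2 hti
  obtain ⟨T, hTs, hTc⟩ := Finset.exists_subset_card_eq hT
  have hTr : (T.card : ℝ) = (B : ℝ) - d + 1 := by
    rw [hTc]; push_cast [Nat.cast_sub hdB]; ring
  rw [← Finset.sum_add_sum_compl T]
  have h1 := Finset.card_nsmul_le_sum T (fun i => mutualInfo X (q i)) (M - η)
    fun i hi => hS i (Finset.mem_filter.1 (hTs hi)).2
  have h2 := Finset.card_nsmul_le_sum Tᶜ (fun i => mutualInfo X (q i)) (B * η) fun i _ => hW i
  have hTcc : (Tᶜ.card : ℝ) = (d : ℝ) - 1 := by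
    rw [Finset.card_compl, Fintype.card_fin, Nat.cast_sub (by omega), hTr]; ring
  rw [nsmul_eq_mul, hTr] at h1
  rw [nsmul_eq_mul, hTcc] at h2
  -- For `d = 1` all blocks are strong and `η ≤ M - R` suffices. For `d ≥ 2` a single remaining
  -- block, with its `B * η` bits, covers the deficits of all strong ones.
  rcases hd.eq_or_lt with rfl | hd2
  · simp only [Nat.cast_one, sub_add_cancel, sub_self, zero_mul] at h1 h2
    nlinarith
  · have hd2' : (2 : ℝ) ≤ d := by exact_mod_cast hd2
    nlinarith [mul_pos hB' hη0]

/-! ### Truncated channel inversion: admissibility and outage. -/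

/-- Truncated channel inversion, quantized to `J` levels and applied to the weakest `d` blocks. -/
def inversionPower {B : ℕ} (d k J : ℕ) (S δ : ℝ) (g : Fin B → ℝ) : ℝ :=
  ∑ A ∈ Finset.powersetCard d Finset.univ, (1 + ∑ j ∈ Finset.range J,
    Set.indicator {g : Fin B → ℝ | ∀ i ∈ A, g i ≤ S ^ (-(j * δ))}
      (fun _ => S ^ ((j + 1) * δ * k)) g)

section
variable {B m d k J : ℕ} {S δ : ℝ}

theorem measurableSet_forall_le (A : Finset (Fin B)) (x : ℝ) :
    MeasurableSet {g : Fin B → ℝ | ∀ i ∈ A, g i ≤ x} := by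
  have : {g : Fin B → ℝ | ∀ i ∈ A, g i ≤ x} = ⋂ i ∈ A, {g : Fin B → ℝ | g i ≤ x} := by
    ext g; simp
  rw [this]
  exact Finset.measurableSet_biInter _ fun i _ =>
    measurableSet_le (measurable_pi_apply i) measurable_const

theorem measurable_inversionPower :
    Measurable (inversionPower d k J S δ : (Fin B → ℝ) → ℝ) := by
  unfold inversionPower
  refine Finset.measurable_fun_sum _ fun A _ => measurable_const.add ?_
  exact Finset.measurable_fun_sum _ fun j _ =>
    measurable_const.indicator (measurableSet_forall_le A _)

theorem one_add_sum_indicator_le_inversionPower (hS : 0 < S) {A : Finset (Fin B)}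
    (hA : A.card = d) (g : Fin B → ℝ) :
    1 + ∑ j ∈ Finset.range J, Set.indicator {g : Fin B → ℝ | ∀ i ∈ A, g i ≤ S ^ (-(j * δ))}
      (fun _ => S ^ ((j + 1) * δ * k)) g ≤ inversionPower d k J S δ g := by
  have hnn : ∀ A : Finset (Fin B), 0 ≤ ∑ j ∈ Finset.range J,
      Set.indicator {g : Fin B → ℝ | ∀ i ∈ A, g i ≤ S ^ (-(j * δ))}
      (fun _ => S ^ ((j + 1) * δ * k)) g := fun A => Finset.sum_nonneg fun j _ =>
    Set.indicator_nonneg (fun _ _ => by positivity) _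
  exact Finset.single_le_sum (f := fun A : Finset (Fin B) => 1 + ∑ j ∈ Finset.range J,
    Set.indicator {g : Fin B → ℝ | ∀ i ∈ A, g i ≤ S ^ (-(j * δ))}
      (fun _ => S ^ ((j + 1) * δ * k)) g) (fun A _ => by linarith [hnn A])
    (Finset.mem_powersetCard.2 ⟨Finset.subset_univ A, hA⟩)

theorem one_le_inversionPower (hS : 0 < S) {A : Finset (Fin B)} (hA : A.card = d)
    (g : Fin B → ℝ) : 1 ≤ inversionPower d k J S δ g := by
  refine le_trans ?_ (one_add_sum_indicator_le_inversionPower hS hA g)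
  exact le_add_of_nonneg_right (Finset.sum_nonneg fun j _ =>
    Set.indicator_nonneg (fun _ _ => by positivity) _)

theorem rpow_le_inversionPower (hS : 0 < S) {A : Finset (Fin B)} (hA : A.card = d)
    {g : Fin B → ℝ} {j : ℕ} (hj : j < J) (hg : ∀ i ∈ A, g i ≤ S ^ (-(j * δ))) :
    S ^ ((j + 1) * δ * k) ≤ inversionPower d k J S δ g := by
  refine le_trans ?_ (one_add_sum_indicator_le_inversionPower hS hA g)
  have h := Finset.single_le_sum (f := fun j : ℕ =>
    Set.indicator {g : Fin B → ℝ | ∀ i ∈ A, g i ≤ S ^ (-(j * δ))}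
      (fun _ => S ^ ((j + 1) * δ * k)) g)
    (fun j _ => Set.indicator_nonneg (fun _ _ => by positivity) _) (Finset.mem_range.2 hj)
  have hm : g ∈ {g : Fin B → ℝ | ∀ i ∈ A, g i ≤ S ^ (-(j * δ))} := hg
  simp only [Set.indicator_of_mem hm] at h
  linarith

theorem integrable_inversionPower (v : ℝ≥0) :
    Integrable (fun h : Fin B → Fin m → ℂ => inversionPower d k J S δ (gains h))
      (gaussianBlocks B m v) := by
  unfold inversionPower
  refine integrable_finsetSum _ fun A _ => (integrable_const _).add
    (integrable_finsetSum _ fun j _ => ?_)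
  exact (integrable_const (S ^ (((j : ℝ) + 1) * δ * k))).indicator
    (measurable_gains (measurableSet_forall_le A (S ^ (-(j * δ)))))

/-- Level `j` is active with probability at most a constant times `S ^ (-j * δ * k)` and costs `S ^
((j + 1) * δ * k)`, so every level contributes the same order `S ^ (δ * k)`: the price of
quantization. -/
theorem integral_inversionPower_le (hS : 1 ≤ S) (hδ : 0 ≤ δ) {v : ℝ≥0} (hv : (1 / 2 : ℝ) ≤ v) :
    ∫ h, inversionPower d (m * d) J S δ (gains h) ∂(gaussianBlocks B m v) ≤
      (2 ^ B * (1 + J * 4 ^ (m * d))) * S ^ (δ * (m * d : ℕ)) := by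
  have hS0 : 0 < S := by linarith
  have hv0 : (0 : ℝ) < v := by linarith
  set k := m * d with hk
  have hmeas : ∀ (A : Finset (Fin B)) (x : ℝ),
      MeasurableSet {h : Fin B → Fin m → ℂ | ∀ i ∈ A, gains h i ≤ x} := fun A x =>
    measurable_gains (measurableSet_forall_le A x)
  have hind : ∀ (A : Finset (Fin B)) (j : ℕ) (h : Fin B → Fin m → ℂ),
      Set.indicator {g : Fin B → ℝ | ∀ i ∈ A, g i ≤ S ^ (-(j * δ))}
        (fun _ => S ^ (((j : ℝ) + 1) * δ * k)) (gains h) =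
      Set.indicator {h : Fin B → Fin m → ℂ | ∀ i ∈ A, gains h i ≤ S ^ (-(j * δ))}
        (fun _ => S ^ (((j : ℝ) + 1) * δ * k)) h := fun A j h => rfl
  have hint : ∀ (A : Finset (Fin B)) (j : ℕ), Integrable
      (Set.indicator {h : Fin B → Fin m → ℂ | ∀ i ∈ A, gains h i ≤ S ^ (-(j * δ))}
        (fun _ => S ^ (((j : ℝ) + 1) * δ * k))) (gaussianBlocks B m v) := fun A j =>
    (integrable_const _).indicator (hmeas A _)
  have hterm : ∀ (A : Finset (Fin B)) (j : ℕ), A.card = d →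
      ∫ h, Set.indicator {h : Fin B → Fin m → ℂ | ∀ i ∈ A, gains h i ≤ S ^ (-(j * δ))}
        (fun _ => S ^ (((j : ℝ) + 1) * δ * k)) h ∂(gaussianBlocks B m v) ≤
      4 ^ k * S ^ (δ * k) := fun A j hA => by
    rw [integral_indicator_const _ (hmeas A _), smul_eq_mul]
    have h1 := gaussianBlocks_real_gains_le_le (m := m) (NNReal.coe_ne_zero.1 hv0.ne') A
      (Real.rpow_nonneg hS0.le (-(j * δ)))
    rw [hA, ← hk] at h1
    have h2 : 2 * S ^ (-(j * δ)) / v ≤ 4 * S ^ (-(j * δ)) := by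
      rw [div_le_iff₀ hv0]
      nlinarith [Real.rpow_pos_of_pos hS0 (-(j * δ))]
    refine (mul_le_mul_of_nonneg_right (h1.trans (pow_le_pow_left₀ (by positivity) h2 k))
      (by positivity)).trans (le_of_eq ?_)
    rw [mul_pow, mul_assoc, ← Real.rpow_natCast (S ^ (-(j * δ))), ← Real.rpow_mul hS0.le,
      ← Real.rpow_add hS0]
    congr 2; ring
  unfold inversionPower
  simp_rw [hind]
  have hsum : ∀ A : Finset (Fin B), Integrable (fun h => 1 + ∑ j ∈ Finset.range J,
      Set.indicator {h : Fin B → Fin m → ℂ | ∀ i ∈ A, gains h i ≤ S ^ (-(j * δ))}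
      (fun _ => S ^ (((j : ℝ) + 1) * δ * k)) h) (gaussianBlocks B m v) := fun A =>
    (integrable_const _).add (integrable_finsetSum _ fun j _ => hint A j)
  rw [integral_finsetSum _ fun A _ => hsum A]
  have hA : ∀ A ∈ Finset.powersetCard d (Finset.univ : Finset (Fin B)),
      ∫ h, (1 + ∑ j ∈ Finset.range J,
        Set.indicator {h : Fin B → Fin m → ℂ | ∀ i ∈ A, gains h i ≤ S ^ (-(j * δ))}
        (fun _ => S ^ (((j : ℝ) + 1) * δ * k)) h) ∂(gaussianBlocks B m v) ≤
      (1 + J * 4 ^ k) * S ^ (δ * k) := fun A hA => by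
    rw [integral_add (integrable_const _) (integrable_finsetSum _ fun j _ => hint A j),
      integral_finsetSum _ fun j _ => hint A j, integral_const, probReal_univ, one_smul, add_mul]
    refine add_le_add ?_ ?_
    · rw [one_mul]; exact Real.one_le_rpow hS (by positivity)
    · refine (Finset.sum_le_card_nsmul _ _ _ fun j _ =>
        hterm A j (Finset.mem_powersetCard.1 hA).2).trans (le_of_eq ?_)
      rw [Finset.card_range, nsmul_eq_mul, mul_assoc]
  refine (Finset.sum_le_card_nsmul _ _ _ hA).trans ?_
  rw [nsmul_eq_mul, mul_assoc]
  refine mul_le_mul_of_nonneg_right ?_ (by positivity)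
  have : (Finset.powersetCard d (Finset.univ : Finset (Fin B))).card ≤ 2 ^ B := by
    rw [Finset.card_powersetCard, Finset.card_univ, Fintype.card_fin]
    exact Nat.choose_le_two_pow B d
  exact_mod_cast this

theorem gains_le_two_mul_add (h e : Fin B → Fin m → ℂ) (i : Fin B) :
    gains h i ≤ 2 * gains (h + e) i + 2 * gains e i := by
  simp only [gains, Finset.mul_sum, ← Finset.sum_add_distrib]
  refine Finset.sum_le_sum fun j _ => ?_
  simp only [norm_sq_eq, Pi.add_apply, Complex.add_re, Complex.add_im]
  nlinarith [sq_nonneg ((h i j).re + 2 * (e i j).re), sq_nonneg ((h i j).im + 2 * (e i j).im)]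

/-- The truncated channel inversion, uniform over the blocks and limited to the peak power. -/
def inversionAllocation (B d k J : ℕ) (S δ δ' dpeak : ℝ) : PowerAllocation B :=
  fun g _ => min (S ^ dpeak) (S ^ (1 - δ') * inversionPower d k J S δ g)

/-- If `d` blocks are received weakly in spite of the channel inversion, then either their gains
are small or the noise of the channel estimate is large. -/
theorem small_gains_or_large_noise {de δ' dpeak a : ℝ} (hk : 1 ≤ k) (hJ : 0 < J) (hS : 1 ≤ S)
    (hδ0 : 0 ≤ δ) (hδ' : 0 ≤ δ') (hδ : J * δ = de) (ha1 : a ≤ dpeak) (ha2 : a ≤ 1 + k * de)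
    (hS4 : S ^ (δ + δ' - 1) ≤ 1 / 4) {h e : Fin B → Fin m → ℂ} {A : Finset (Fin B)}
    (hA : A.card = d)
    (hw : ∀ i ∈ A, inversionAllocation B d k J S δ δ' dpeak (gains h) i * gains (h + e) i ≤ S ^ δ) :
    (∀ i ∈ A, gains (h + e) i ≤ S ^ (δ + δ' - a)) ∨ ∃ i, S ^ δ * S ^ (-de) / 4 ≤ gains e i := by
  have hS0 : 0 < S := by linarith
  set w := S ^ (1 - δ') * inversionPower d k J S δ (gains h) with hwdef
  have hbound : ∀ {b : ℝ} {i}, i ∈ A → S ^ b ≤ min (S ^ dpeak) w →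
      gains (h + e) i ≤ S ^ (δ - b) := fun {b i} hi hb => by
    have h1 := (mul_le_mul_of_nonneg_right hb (gains_nonneg (h + e) i)).trans (hw i hi)
    rw [Real.rpow_sub hS0, le_div_iff₀ (by positivity), mul_comm]
    exact h1
  -- If the full power `S ^ (a - δ')` is spent, weak reception directly bounds the true gains.
  -- Otherwise the peak constraint is inactive.
  by_cases hpk : S ^ (a - δ') ≤ min (S ^ dpeak) w
  · left
    intro i hi
    refine (hbound hi hpk).trans (le_of_eq ?_)
    congr 1; ring
  right
  have hpk1 : S ^ (a - δ') ≤ S ^ dpeak := Real.rpow_le_rpow_of_exponent_le hS (by linarith)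
  have hwlt : w < S ^ (a - δ') := by
    by_contra hc
    exact hpk (le_min hpk1 (not_lt.1 hc))
  have hmin : min (S ^ dpeak) w = w := min_eq_right (hwlt.le.trans hpk1)
  rw [hmin] at hbound
  have hwle : ∀ {j : ℕ}, j < J → (∀ i ∈ A, gains h i ≤ S ^ (-(j * δ))) →
      S ^ (1 - δ' + ((j + 1 : ℕ) : ℝ) * δ * k) ≤ w := fun {j} hj hg => by
    rw [Real.rpow_add hS0, hwdef]
    push_cast
    exact mul_le_mul_of_nonneg_left (rpow_le_inversionPower hS0 hA hj hg) (by positivity)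
  -- The last level, `J - 1`, would already supply `S ^ (1 - δ' + k * de) ≥ S ^ (a - δ')`, so some
  -- level fails. The first failing level `j` gives a block of `A` with estimated gain above `S ^
  -- (-j * δ)`, and level `j - 1`, or the constant `1` if `j = 0`, gives the power.
  have hex : ∃ j, ∃ i ∈ A, S ^ (-((j : ℕ) * δ)) < gains h i := by
    by_contra hc
    push Not at hc
    have h1 := hwle (j := J - 1) (by omega) (hc _)
    rw [Nat.sub_add_cancel hJ, hδ] at h1
    have h2 : S ^ (a - δ') ≤ S ^ (1 - δ' + de * k) :=
      Real.rpow_le_rpow_of_exponent_le hS (by linarith)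
    linarith
  classical
  obtain ⟨i, hi, hgi⟩ := Nat.find_spec hex
  set j := Nat.find hex with hj
  have hbelow : ∀ l < j, ∀ i ∈ A, gains h i ≤ S ^ (-((l : ℕ) * δ)) := fun l hl i hi => by
    have := Nat.find_min hex hl
    push Not at this
    exact this i hi
  have hjJ : j < J := by
    by_contra hc
    have h1 := hwle (j := J - 1) (by omega) (hbelow _ (by omega))
    rw [Nat.sub_add_cancel hJ, hδ] at h1
    have h2 : S ^ (a - δ') ≤ S ^ (1 - δ' + de * k) :=
      Real.rpow_le_rpow_of_exponent_le hS (by linarith)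
    linarith
  have hwj : S ^ (1 - δ' + (j : ℝ) * δ * k) ≤ w := by
    rcases Nat.eq_zero_or_pos j with h0 | h0
    · rw [h0, Nat.cast_zero, zero_mul, zero_mul, add_zero, hwdef]
      exact le_mul_of_one_le_right (by positivity) (one_le_inversionPower hS0 hA _)
    · have h1 := hwle (j := j - 1) (by omega) (hbelow _ (by omega))
      rwa [Nat.sub_add_cancel h0] at h1
  have hk' : (1 : ℝ) ≤ k := by exact_mod_cast hk
  -- Since `k ≥ 1`, the power more than inverts the estimated gain. A true gain this much smaller
  -- forces the error gain to be at least a quarter of the estimated one, hence at least `S ^ (δ -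
  -- de) / 4` because `j + 1 ≤ J`.
  have hsmall : gains (h + e) i ≤ 1 / 4 * gains h i := by
    refine (hbound hi hwj).trans ?_
    have h1 : S ^ (δ - (1 - δ' + (j : ℝ) * δ * k)) ≤ S ^ (δ + δ' - 1) * S ^ (-(j * δ)) := by
      rw [← Real.rpow_add hS0]
      refine Real.rpow_le_rpow_of_exponent_le hS ?_
      have : (j : ℝ) * δ * 1 ≤ j * δ * k := mul_le_mul_of_nonneg_left hk' (by positivity)
      linarith
    exact h1.trans (mul_le_mul hS4 hgi.le (by positivity) (by norm_num))
  refine ⟨i, ?_⟩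
  have h1 := gains_le_two_mul_add h e i
  have h2 : S ^ δ * S ^ (-de) ≤ S ^ (-(j * δ)) := by
    rw [← Real.rpow_add hS0]
    refine Real.rpow_le_rpow_of_exponent_le hS ?_
    have : ((j : ℝ) + 1) * δ ≤ J * δ :=
      mul_le_mul_of_nonneg_right (by exact_mod_cast hjJ) hδ0
    linarith
  linarith

end

section
variable {B m d k J : ℕ} {S δ de dpeak : ℝ}

theorem avgPower_inversionAllocation (hB : 0 < B) (δ' : ℝ) (g : Fin B → ℝ) :
    avgPower (inversionAllocation B d k J S δ δ' dpeak) g =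
      min (S ^ dpeak) (S ^ (1 - δ') * inversionPower d k J S δ g) := by
  have hB' : (B : ℝ) ≠ 0 := by positivity
  simp [avgPower, inversionAllocation, hB']

theorem inversionPower_nonneg (hS : 0 < S) (g : Fin B → ℝ) : 0 ≤ inversionPower d k J S δ g :=
  Finset.sum_nonneg fun A _ => add_nonneg zero_le_one (Finset.sum_nonneg fun j _ =>
    Set.indicator_nonneg (fun _ _ => by positivity) _)

theorem admissible_inversionAllocation (hB : 0 < B) (hS : 1 ≤ S) (hδ : 0 ≤ δ) {δ' : ℝ}
    (hε : (csitNoiseVar de S : ℝ) ≤ 1 / 2)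
    (hδ' : (2 ^ B * (1 + J * 4 ^ (m * d))) * S ^ (δ * (m * d : ℕ)) ≤ S ^ δ') :
    Admissible B m de dpeak S (inversionAllocation B d (m * d) J S δ δ' dpeak) where
  measurable := measurable_pi_lambda _ fun _ =>
    measurable_const.min (measurable_const.mul measurable_inversionPower)
  nonneg g i := by
    have hS0 : 0 < S := by linarith
    have := inversionPower_nonneg (d := d) (k := m * d) (J := J) (δ := δ) hS0 g
    exact le_min (by positivity) (by positivity)
  peak g := by rw [avgPower_inversionAllocation hB]; exact min_le_left _ _
  average := by
    have hS0 : 0 < S := by linarith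
    have hv : (1 / 2 : ℝ) ≤ ((1 - csitNoiseVar de S : ℝ≥0) : ℝ) := by
      rw [NNReal.coe_sub (by rw [← NNReal.coe_le_coe, NNReal.coe_one]; linarith), NNReal.coe_one]
      linarith
    simp_rw [avgPower_inversionAllocation hB]
    rw [csitLaw, integral_fun_fst (fun h => min (S ^ dpeak)
      (S ^ (1 - δ') * inversionPower d (m * d) J S δ (gains h))), probReal_univ, one_smul]
    have hint := (integrable_inversionPower (B := B) (m := m) (d := d) (k := m * d) (J := J)
      (S := S) (δ := δ) (1 - csitNoiseVar de S)).const_mul (S ^ (1 - δ'))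
    calc _ ≤ ∫ h, S ^ (1 - δ') * inversionPower d (m * d) J S δ (gains h)
          ∂(gaussianBlocks B m (1 - csitNoiseVar de S)) := by
          refine integral_mono_of_nonneg (ae_of_all _ fun h => ?_) hint
            (ae_of_all _ fun h => min_le_right _ _)
          have := inversionPower_nonneg (d := d) (k := m * d) (J := J) (δ := δ) hS0 (gains h)
          exact le_min (by positivity) (by positivity)
      _ ≤ S ^ (1 - δ') * S ^ δ' := by
          rw [integral_const_mul]
          exact mul_le_mul_of_nonneg_left ((integral_inversionPower_le hS hδ hv).trans hδ')
            (by positivity)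
      _ = S := by rw [← Real.rpow_add hS0, sub_add_cancel, Real.rpow_one]

theorem csitLaw_real_gains_le_le (hde : 0 ≤ de) (hS : 1 ≤ S) (A : Finset (Fin B)) {x : ℝ}
    (hx : 0 ≤ x) :
    (csitLaw B m de S).real {z | ∀ i ∈ A, gains (z.1 + z.2) i ≤ x} ≤
      (2 * x) ^ (m * A.card) := by
  have h := gaussianBlocks_real_gains_le_le (m := m) (v := 1) one_ne_zero A hx
  have hms : MeasurableSet {h : Fin B → Fin m → ℂ | ∀ i ∈ A, gains h i ≤ x} :=
    measurable_gains (measurableSet_forall_le A x)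
  rw [← map_add_csitLaw B m hde hS, map_measureReal_apply (by fun_prop) hms, NNReal.coe_one, div_one] at h
  exact h

theorem csitLaw_real_noise_gain_ge_le (hm : 0 < m) (i : Fin B) {t : ℝ} (ht : 0 ≤ t) :
    (csitLaw B m de S).real {z | t ≤ gains z.2 i} ≤
      m * (4 * Real.exp (-t / (2 * m * csitNoiseVar de S))) := by
  have hs : {z : (Fin B → Fin m → ℂ) × (Fin B → Fin m → ℂ) | t ≤ gains z.2 i} =
      Set.univ ×ˢ {e | t ≤ gains e i} := by
    ext z; simp
  rw [hs, csitLaw, measureReal_prod_prod, probReal_univ, one_mul]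
  exact gaussianBlocks_real_gain_ge_le _ hm i ht

/-- An outage needs `d` small gains, a large estimation error, or one exponentially small gain. The
first event gives the exponent, and the other two are smaller than any power of `S`. -/
theorem exists_admissible_outageProb_le {X : Finset ℂ} {M R a : ℝ}
    (hcard : (X.card : ℝ) = 2 ^ M) (hmean : ∑ x ∈ X, x = 0)
    (henergy : (∑ x ∈ X, ‖x‖ ^ 2) / X.card = 1) (hRM : R < M) (hm : 0 < m) (hd : 1 ≤ d)
    (hdB : d ≤ B) (hBR : (B : ℝ) * R ≤ ((B : ℝ) - d + 1) * M) (hde : 0 < de) (hdpeak : 0 ≤ dpeak)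
    (ha1 : a ≤ dpeak) (ha2 : a ≤ 1 + (m * d : ℕ) * de) {η : ℝ} (hη : 0 < η) :
    ∀ᶠ S in atTop, ∃ P, Admissible B m de dpeak S P ∧
      outageProb B m X R de S P ≤ S ^ (-((m * d : ℕ) * a) + η) := by
  have hB : 0 < B := by omega
  obtain ⟨k, hk⟩ : ∃ k, k = m * d := ⟨_, rfl⟩
  have hk0 : 1 ≤ k := by rw [hk]; exact Nat.mul_pos hm hd
  have hk0' : (1 : ℝ) ≤ k := by exact_mod_cast hk0
  have hm' : (0 : ℝ) < m := by exact_mod_cast hm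
  -- The two bounds ensure `δ + δ' < 1`, so that inversion beats the weakness threshold `S ^ δ`, and
  -- `k * (δ + δ') < η`, so that quantization costs less than the allowed exponent.
  obtain ⟨J, hJ⟩ := exists_nat_gt (max (de * (k + 2)) (k * (de * (k + 2)) / η))
  have hJ1 := (le_max_left _ _).trans_lt hJ
  have hJ2 := (le_max_right _ _).trans_lt hJ
  have hJr : (0 : ℝ) < J := lt_trans (by positivity) hJ1
  have hJ0 : 0 < J := by exact_mod_cast hJr
  obtain ⟨δ, hδ⟩ : ∃ δ, δ = de / J := ⟨_, rfl⟩
  have hδ0 : 0 < δ := by rw [hδ]; positivity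
  have hJδ : J * δ = de := by rw [hδ]; field_simp
  -- Being strictly larger than `δ * k`, this absorbs the constant in the mean of the inversion
  -- power.
  obtain ⟨δ', hδ'⟩ : ∃ δ', δ' = δ * (k + 1) := ⟨_, rfl⟩
  have hδ'0 : 0 < δ' := by rw [hδ']; positivity
  have hsum : δ + δ' = de * (k + 2) / J := by rw [hδ', hδ]; field_simp; ring
  have hlt1 : δ + δ' < 1 := by rwa [hsum, div_lt_one hJr]
  have hltη : k * (δ + δ') < η := by
    rw [hsum, mul_div_assoc', div_lt_iff₀ hJr, mul_comm η]
    rwa [div_lt_iff₀ hη] at hJ2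
  obtain ⟨K, hK, c, hc, hstrong⟩ :=
    exists_strong_blocks_no_outage hcard hmean henergy hRM hd hdB hBR
  rw [← hk] at ha2 ⊢
  set w := -((k : ℝ) * a) + η with hw
  filter_upwards [(tendsto_rpow_atTop hδ0).eventually hstrong, eventually_ge_atTop 1,
    eventually_csitNoiseVar_le_half hde,
    eventually_const_mul_rpow_le (show δ * k < δ' by rw [hδ']; linarith)
      (2 ^ B * (1 + J * 4 ^ k)),
    eventually_const_mul_rpow_le (show δ + δ' - 1 < 0 by linarith) 4,
    eventually_const_mul_rpow_le (show k * (δ + δ' - a) < w by rw [hw]; linarith)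
      (3 * (2 ^ B * 2 ^ k)),
    eventually_const_mul_exp_neg_rpow_le (show 0 < 1 / (8 * (m : ℝ)) by positivity) hδ0
      (3 * (B * (m * 4))) w,
    eventually_const_mul_exp_neg_rpow_le hc hδ0 (3 * (B * (2 * K))) w,
    eventually_const_mul_exp_neg_rpow_le hc hδ0 (2 * K) 0]
    with S hstrong hS hε hadm hS4 hb1 hb2 hb3 hκ1
  have hS0 : 0 < S := by linarith
  refine ⟨inversionAllocation B d k J S δ δ' dpeak, ?_, ?_⟩
  · rw [hk]
    rw [hk] at hadm
    exact admissible_inversionAllocation hB hS hδ0.le hε hadm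
  rw [Real.rpow_zero] at hS4 hκ1
  obtain ⟨κ, hκ⟩ : ∃ κ, κ = K * Real.exp (-(c * S ^ δ)) := ⟨_, rfl⟩
  have hκ0 : 0 < κ := by rw [hκ]; positivity
  rw [mul_assoc, ← hκ] at hκ1
  rw [← hκ] at hstrong
  set x := S ^ (δ + δ' - a) with hx
  set y := S ^ δ * S ^ (-de) / 4 with hy
  have hsub : {z : (Fin B → Fin m → ℂ) × (Fin B → Fin m → ℂ) | (∑ i, mutualInfo X
      (inversionAllocation B d k J S δ δ' dpeak (gains z.1) i * gains (z.1 + z.2) i)) / B < R} ⊆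
      ((⋃ A ∈ Finset.powersetCard d Finset.univ, {z | ∀ i ∈ A, gains (z.1 + z.2) i ≤ x}) ∪
        ⋃ i, {z | y ≤ gains z.2 i}) ∪
        ⋃ i : Fin B, {z | ∀ l ∈ ({i} : Finset (Fin B)), gains (z.1 + z.2) l ≤ κ} := by
    intro z hz
    have hz' : ¬ R ≤ (∑ i, mutualInfo X
      (inversionAllocation B d k J S δ δ' dpeak (gains z.1) i * gains (z.1 + z.2) i)) / B :=
      not_le.2 hz
    by_contra hc
    simp only [Set.mem_union, Set.mem_iUnion, Set.mem_ofPred_eq, not_or, not_exists,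
      Finset.mem_singleton, forall_eq, not_le] at hc
    obtain ⟨⟨hc1, hc2⟩, hc3⟩ := hc
    refine hz' (hstrong _ (fun A hA => ?_) fun i => ?_)
    · by_contra hcon
      push Not at hcon
      rcases small_gains_or_large_noise hk0 hJ0 hS hδ0.le hδ'0.le hJδ ha1 ha2 (by linarith) hA hcon
        with h | ⟨i, h⟩
      · exact hc1 A (Finset.mem_powersetCard.2 ⟨Finset.subset_univ A, hA⟩) h
      · exact absurd h (not_le.2 (hc2 i))
    · obtain ⟨A, -, hA⟩ := Finset.exists_subset_card_eq
        (show d ≤ (Finset.univ : Finset (Fin B)).card by simpa using hdB)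
      -- Every block gets at least unit power, so its received power is at least its true gain,
      -- which exceeds `κ`.
      have h1 : 1 ≤ inversionAllocation B d k J S δ δ' dpeak (gains z.1) i := by
        refine le_min (Real.one_le_rpow hS hdpeak) ?_
        exact one_le_mul_of_one_le_of_one_le (Real.one_le_rpow hS (by linarith))
          (one_le_inversionPower hS0 hA _)
      have h2 := hc3 i
      nlinarith
  refine (measureReal_mono hsub).trans ((measureReal_union_le _ _).trans
    ((add_le_add_left (measureReal_union_le _ _) _).trans ?_))
  have e1 : (csitLaw B m de S).real (⋃ A ∈ Finset.powersetCard d Finset.univ,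
      {z | ∀ i ∈ A, gains (z.1 + z.2) i ≤ x}) ≤ S ^ w / 3 := by
    refine (measureReal_biUnion_finset_le _ _).trans ?_
    have h1 : ∀ A ∈ Finset.powersetCard d (Finset.univ : Finset (Fin B)),
        (csitLaw B m de S).real {z | ∀ i ∈ A, gains (z.1 + z.2) i ≤ x} ≤ (2 * x) ^ k :=
      fun A hA => by
        have := csitLaw_real_gains_le_le (m := m) hde.le hS A (show 0 ≤ x by positivity)
        rwa [(Finset.mem_powersetCard.1 hA).2, ← hk] at this
    refine (Finset.sum_le_card_nsmul _ _ _ h1).trans ?_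
    have h2 : ((Finset.powersetCard d (Finset.univ : Finset (Fin B))).card : ℝ) ≤ 2 ^ B := by
      rw [Finset.card_powersetCard, Finset.card_univ, Fintype.card_fin]
      exact_mod_cast Nat.choose_le_two_pow B d
    have h3 : x ^ k = S ^ (k * (δ + δ' - a)) := by
      rw [hx, ← Real.rpow_natCast, ← Real.rpow_mul hS0.le, mul_comm]
    rw [nsmul_eq_mul, mul_pow, h3]
    have h4 := mul_le_mul_of_nonneg_right h2
      (show 0 ≤ 2 ^ k * S ^ (k * (δ + δ' - a)) by positivity)
    linarith
  have e2 : (csitLaw B m de S).real (⋃ i, {z | y ≤ gains z.2 i}) ≤ S ^ w / 3 := by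
    refine (measureReal_iUnion_fintype_le _).trans ?_
    have h1 : ∀ i : Fin B, (csitLaw B m de S).real {z | y ≤ gains z.2 i} ≤
        m * (4 * Real.exp (-(1 / (8 * m) * S ^ δ))) := fun i => by
      refine (csitLaw_real_noise_gain_ge_le hm i (by positivity)).trans (le_of_eq ?_)
      rw [csitNoiseVar_coe hS0, hy]
      have : 0 < S ^ (-de) := by positivity
      congr 3
      field_simp
      norm_num
    refine (Finset.sum_le_sum fun i _ => h1 i).trans ?_
    rw [Finset.sum_const, Finset.card_univ, Fintype.card_fin, nsmul_eq_mul]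
    linarith
  have e3 : (csitLaw B m de S).real
      (⋃ i : Fin B, {z | ∀ l ∈ ({i} : Finset (Fin B)), gains (z.1 + z.2) l ≤ κ}) ≤
      S ^ w / 3 := by
    refine (measureReal_iUnion_fintype_le _).trans ?_
    have h1 : ∀ i : Fin B, (csitLaw B m de S).real
        {z | ∀ l ∈ ({i} : Finset (Fin B)), gains (z.1 + z.2) l ≤ κ} ≤ 2 * κ := fun i => by
      refine (csitLaw_real_gains_le_le hde.le hS {i} hκ0.le).trans ?_
      rw [Finset.card_singleton, mul_one]
      exact pow_le_of_le_one (by positivity) hκ1 hm.ne'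
    refine (Finset.sum_le_sum fun i _ => h1 i).trans ?_
    rw [Finset.sum_const, Finset.card_univ, Fintype.card_fin, nsmul_eq_mul, hκ]
    linarith
  linarith

end

/-! ### From the two bounds to the exponent of the optimal outage probability. -/

theorem tendsto_neg_log_div_log {f : ℝ → ℝ} {L c : ℝ} (hc : 0 < c)
    (hlow : ∀ᶠ S in atTop, c * S ^ (-L) ≤ f S)
    (hup : ∀ η > 0, ∀ᶠ S in atTop, f S ≤ S ^ (-L + η)) :
    (∀ᶠ S in atTop, 0 < f S) ∧
      Tendsto (fun S => -Real.log (f S) / Real.log S) atTop (𝓝 L) := by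
  have hpos : ∀ᶠ S in atTop, 0 < f S := by
    filter_upwards [hlow, eventually_gt_atTop 0] with S h h0
    exact lt_of_lt_of_le (by positivity) h
  refine ⟨hpos, tendsto_order.2 ⟨fun b hb => ?_, fun b hb => ?_⟩⟩
  · filter_upwards [hup ((L - b) / 2) (by linarith), hpos, eventually_gt_atTop 1] with S h hf hS
    have hl := Real.log_pos hS
    have h1 := Real.log_le_log hf h
    rw [Real.log_rpow (by linarith)] at h1
    rw [lt_div_iff₀ hl]
    nlinarith
  · filter_upwards [hlow, hpos, eventually_gt_atTop 1,
      eventually_const_mul_rpow_le (show -((b - L) / 2) < 0 by linarith) c⁻¹] with S h hf hS hη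
    have hl := Real.log_pos hS
    have hS0 : 0 < S := by linarith
    rw [Real.rpow_zero, inv_mul_le_iff₀ hc, mul_one] at hη
    have h1 := Real.log_le_log (by positivity)
      ((mul_le_mul_of_nonneg_right hη (by positivity : 0 ≤ S ^ (-L))).trans h)
    rw [← Real.rpow_add hS0, Real.log_rpow hS0] at h1
    rw [div_lt_iff₀ hl]
    nlinarith

theorem optimalOutage_le {B m : ℕ} {X : Finset ℂ} {R de dpeak snr : ℝ} {P : PowerAllocation B}
    (hP : Admissible B m de dpeak snr P) :
    optimalOutage B m X R de dpeak snr ≤ outageProb B m X R de snr P :=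
  csInf_le ⟨0, by rintro _ ⟨Q, -, rfl⟩; exact measureReal_nonneg⟩ ⟨P, hP, rfl⟩

theorem le_optimalOutage {B m : ℕ} {X : Finset ℂ} {R de dpeak snr b : ℝ} (hsnr : 0 < snr)
    (h : ∀ P, Admissible B m de dpeak snr P → b ≤ outageProb B m X R de snr P) :
    b ≤ optimalOutage B m X R de dpeak snr := by
  -- The zero allocation is admissible; without a member the real infimum would default to `0`.
  refine le_csInf ⟨_, fun _ _ => 0, ⟨measurable_const, fun _ _ => le_rfl, ?_, fun _ => ?_⟩, rfl⟩ ?_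
  · simpa [avgPower] using hsnr.le
  · simpa [avgPower] using Real.rpow_nonneg hsnr.le dpeak
  · rintro _ ⟨P, hP, rfl⟩
    exact h P hP

end

end BlockFading

open BlockFading in
theorem theorem1 (B m : ℕ) (hB : 0 < B) (hm : 0 < m)
    (X : Finset ℂ) (M R de dpeak : ℝ)
    (hcard : (X.card : ℝ) = 2 ^ M)
    (hmean : ∑ x ∈ X, x = 0)
    (henergy : (∑ x ∈ X, ‖x‖ ^ 2) / X.card = 1)
    (hR : 0 < R) (hRM : R < M)
    (hde : 0 < de) (hdpeak : 0 ≤ dpeak) :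
    (∀ᶠ snr in atTop, 0 < optimalOutage B m X R de dpeak snr) ∧
    Tendsto (fun snr : ℝ => -Real.log (optimalOutage B m X R de dpeak snr) / Real.log snr) atTop
      (𝓝 (if dpeak ≤ 1 + m * singletonBound B R M * de
          then m * singletonBound B R M * dpeak
          else m * singletonBound B R M * (1 + m * singletonBound B R M * de))) := by
  have hM : 0 < M := hR.trans hRM
  have hB' : (0 : ℝ) < B := by exact_mod_cast hB
  have hn1 : 0 < ⌈(B : ℝ) * R / M⌉ := Int.ceil_pos.2 (by positivity)
  have hn2 : ⌈(B : ℝ) * R / M⌉ ≤ B := Int.ceil_le.2 (by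
    rw [div_le_iff₀ hM]; push_cast; exact mul_le_mul_of_nonneg_left hRM.le hB'.le)
  obtain ⟨d, hd⟩ : ∃ d : ℕ, (d : ℤ) = singletonBound B R M :=
    Int.eq_ofNat_of_zero_le (by unfold singletonBound; omega) |>.imp fun _ h => h.symm
  have hdn : (d : ℤ) = B - ⌈(B : ℝ) * R / M⌉ + 1 := hd
  have hd1 : 1 ≤ d := by omega
  have hdB : d ≤ B := by omega
  have hdr : (d : ℝ) = B - (⌈(B : ℝ) * R / M⌉ : ℝ) + 1 := by exact_mod_cast hdn
  -- The two sides of the ceiling: `B - d` full blocks fall short of the rate, whereas `B - d + 1`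
  -- reach it.
  have hlow : ((B : ℝ) - d) * M < B * R := by
    rw [hdr, ← lt_div_iff₀ hM]
    linarith [Int.ceil_lt_add_one ((B : ℝ) * R / M)]
  have hup : (B : ℝ) * R ≤ ((B : ℝ) - d + 1) * M := by
    rw [hdr, ← div_le_iff₀ hM]
    linarith [Int.le_ceil ((B : ℝ) * R / M)]
  obtain ⟨A, -, hA⟩ := Finset.exists_subset_card_eq
    (show d ≤ (Finset.univ : Finset (Fin B)).card by simpa using hdB)
  have hk : (m : ℝ) * (singletonBound B R M : ℝ) = (m * d : ℕ) := by
    rw [← hd]; push_cast; rfl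
  rw [hk]
  rw [← hA] at hlow
  have hpow : ∀ {snr b : ℝ}, 1 ≤ snr →
      (snr ^ (-b)) ^ (m * d) = snr ^ (-(((m * d : ℕ) : ℝ) * b)) := fun {snr b} h => by
    rw [← Real.rpow_natCast, ← Real.rpow_mul (by linarith)]; congr 1; ring
  split_ifs with hif
  · obtain ⟨c, hc, h⟩ := le_outageProb_of_peak hcard hB hm hde.le hdpeak A hlow
    refine tendsto_neg_log_div_log hc ?_ fun η hη => ?_
    · filter_upwards [eventually_ge_atTop 1] with snr hsnr
      refine le_optimalOutage (by linarith) fun P hP => ?_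
      rw [← hpow hsnr, ← hA]
      exact h snr hsnr P hP
    · filter_upwards [exists_admissible_outageProb_le hcard hmean henergy hRM hm hd1 hdB hup hde
        hdpeak le_rfl hif hη] with snr ⟨P, hP, hle⟩
      exact (optimalOutage_le hP).trans hle
  · obtain ⟨c, hc, h⟩ := le_outageProb_of_average (dpeak := dpeak) hcard hB hm hde A
      (by omega) hlow
    refine tendsto_neg_log_div_log hc ?_ fun η hη => ?_
    · filter_upwards [eventually_ge_atTop 1, h] with snr hsnr h
      refine le_optimalOutage (by linarith) fun P hP => ?_
      rw [← hpow hsnr, ← hA]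
      exact h P hP
    · filter_upwards [exists_admissible_outageProb_le hcard hmean henergy hRM hm hd1 hdB hup hde
        hdpeak (not_le.1 hif).le le_rfl hη] with snr ⟨P, hP, hle⟩
      exact (optimalOutage_le hP).trans hle
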